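/- Let $J\subset\mathbb R$ be an open interval, $s_0\in J$, and let $\gamma=(\gamma_1,\gamma_2):J\to\mathbb R^2$ be a smooth curve with $\gamma(s)=(s,\gamma_2(s))$ for $s$ near $s_0$. Let $m\ge 2$ be an integer and suppose that $\gamma_2$ is of type $m$ at $s_0$, that is, $\gamma_2^{(k)}(s_0)=0$ for $1\le k<m$ and $\gamma_2^{(m)}(s_0)\ne 0$. For $\psi\in C_c^\infty(J)$ and functions $f,g$ on $\mathbb R$ put $$\mathcal M^\gamma(f,g)(x)=\sup_{t_1,t_2>0}\Big|\int f(x-t_1\gamma_1(s))\,g(x-t_2\gamma_2(s))\,\psi(s)\,ds\Big| .$$ Then there is a neighborhood $U$ of $s_0$ such that the following holds for every nonnegative $\psi\in C_c^\infty(J)$ with $\operatorname{supp}\psi\subset U$ and $\psi(s_0)\neq 0$, and all $0<p,q\le\infty$ with $1/r=1/p+1/q$. Consider the estimate $$\|\mathcal M^\gamma(f,g)\|_{L^r(\mathbb R)}\le C\|f\|_{L^p(\mathbb R)}\|g\|_{L^q(\mathbb R)}\quad\text{for all } f\in L^p(\mathbb R),\ g\in L^q(\mathbb R),\qquad(*)$$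 with a finite constant $C$ independent of $f$ and $g$. (i) If $\gamma(s_0)=0$, then $(*)$ holds for some $C$ if and only if $1<p,q,r\le\infty$. (ii) If $\gamma(s_0)\neq 0$ and $s_0=0$, then $(*)$ holds for some $C$ if and only if $1<p\le\infty$, $m<q\le\infty$ and $1<r\le\infty$. (iii) If $\gamma_2(s_0)\neq 0$ and $s_0\neq 0$, then $(*)$ holds for some $C$ if and only if $1<p,q\le\infty$ and $m/q+1/p<1$. Moreover, for exponents for which $(*)$ holds in (i)–(iii), and all $f\in L^p(\mathbb R)$, $g\in L^q(\mathbb R)$, the integrals defining $\mathcal M^\gamma(f,g)(x)$ converge absolutely for almost every $x$ and all $t_1,t_2>0$. -/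

import Mathlib

open MeasureTheory Filter Topology Set
open scoped ENNReal NNReal ContDiff

/-- The integrand `s ↦ f (x - t₁ γ₁(s)) g (x - t₂ γ₂(s)) ψ(s)`. -/
noncomputable def bilinearIntegrand (γ : ℝ → ℝ × ℝ) (ψ : ℝ → ℝ) (f g : ℝ → ℂ)
    (t₁ t₂ x : ℝ) (s : ℝ) : ℂ :=
  f (x - t₁ * (γ s).1) * g (x - t₂ * (γ s).2) * (ψ s : ℂ)

/-- The bilinear maximal function
`𝓜^γ(f,g)(x) = sup_{t₁, t₂ > 0} |∫ f (x - t₁ γ₁(s)) g (x - t₂ γ₂(s)) ψ(s) ds|`, with values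
in `[0, ∞]`. The two parameters vary independently. -/
noncomputable def bilinearMaximal (γ : ℝ → ℝ × ℝ) (ψ : ℝ → ℝ) (f g : ℝ → ℂ) (x : ℝ) : ℝ≥0∞ :=
  ⨆ (t₁ : ℝ) (_ : 0 < t₁) (t₂ : ℝ) (_ : 0 < t₂), ‖∫ s, bilinearIntegrand γ ψ f g t₁ t₂ x s‖ₑ

/-- The estimate `‖𝓜^γ(f,g)‖_{L^r} ≤ C ‖f‖_{L^p} ‖g‖_{L^q}`, with a finite constant `C`
independent of `f ∈ L^p(ℝ)` and `g ∈ L^q(ℝ)`. -/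
def MaximalEstimate (γ : ℝ → ℝ × ℝ) (ψ : ℝ → ℝ) (p q r : ℝ≥0∞) : Prop :=
  ∃ C : ℝ≥0, ∀ f g : ℝ → ℂ, MemLp f p volume → MemLp g q volume →
    eLpNorm (bilinearMaximal γ ψ f g) r volume
      ≤ (C : ℝ≥0∞) * eLpNorm f p volume * eLpNorm g q volume

/-- For all `f ∈ L^p(ℝ)` and `g ∈ L^q(ℝ)` and almost every `x`, all the integrals that enter
`𝓜^γ(f,g)(x)` converge absolutely. -/
def AveragesConverge (γ : ℝ → ℝ × ℝ) (ψ : ℝ → ℝ) (p q : ℝ≥0∞) : Prop :=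
  ∀ f g : ℝ → ℂ, MemLp f p volume → MemLp g q volume →
    ∀ᵐ x : ℝ, ∀ t₁ t₂ : ℝ, 0 < t₁ → 0 < t₂ →
      Integrable (bilinearIntegrand γ ψ f g t₁ t₂ x) volume

/-- `h` is of type `m` at `s`: the derivatives of orders `1, …, m - 1` vanish at `s`, the one of
order `m` does not. -/
def IsOfType (m : ℕ) (h : ℝ → ℝ) (s : ℝ) : Prop :=
  (∀ k : ℕ, 1 ≤ k → k < m → iteratedDeriv k h s = 0) ∧ iteratedDeriv m h s ≠ 0

/-! Sufficiency is a weighted Hölder inequality along the curve. Take a > 1/p, b > 1/q, d > 0 with a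
+ b + d = 1, and powers V₁, V₂, V₃ of |s - s₀| with V₁^a V₂^b V₃^d ≥ 1. If the averages of
V₁|f|^{1/a} and V₂|g|^{1/b} along γ₁ and γ₂ are dominated by the Hardy–Littlewood function M
uniformly in t₁, t₂, and V₃ is integrable, then 𝓜(f,g) ≤ C (M|f|^{1/a})^a (M|g|^{1/b})^b. The
maximal theorem on L^{ap} and L^{bq} and Hölder in x finish; absolute convergence comes with the
same bound (`maximalEstimate_and_averagesConverge_of_weights`).

The substitution u = γ₂(s), with |γ₂'| ≳ |s - s₀|^{m-1}, permits V₂ = |s - s₀|^{m-1}. In the generic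
case V₁ = 1 and V₃ = |s - s₀|^{-β} with β < 1 must compensate, which asks for mb + a < 1. If s₀ = 0,
then V₁ = |s|^{-β} is allowed too, being an integrable radial kernel, and mb < 1 is enough. If
γ₂(s₀) = 0, the Jacobian becomes the integrable kernel |u|^{-(m-1)/m} and no weight is needed.

Necessity uses N dyadic scales at once. Let g be the indicator of [-1,1] and |x| ≈ 2^k. With t₂ =
x/γ₂(σ), contact of order μ at σ keeps x - t₂γ₂(s) in [-1,1] for |s - σ| ≲ 2^{-k/μ}, while t₁ sends
x - t₁s into a set E_k. Take f to be the sum of the L^p-normalised indicators of the disjoint E_k.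
If the claimed inequality fails, every scale contributes at least a constant to ‖𝓜(f,g)‖_r^r, so
N^{1/r} ≲ N^{1/p}, which is absurd for q < ∞; this covers the endpoints as well
(`MaximalEstimate.false_of_dyadic`). The contact point s₀ with μ = m gives the conditions involving
m; a nearby point with μ = 1 gives r > 1 in all three cases. -/

/-! ### The Hardy–Littlewood maximal theorem -/

/-- The uncentred Hardy–Littlewood maximal function on the line, for functions with values in
`[0, ∞]`, normalised by the radius of the balls. -/
noncomputable def hardyLittlewood (H : ℝ → ℝ≥0∞) (x : ℝ) : ℝ≥0∞ :=
  ⨆ (y : ℝ) (R : ℝ) (_ : 0 < R),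
    (Metric.ball y R).indicator (fun _ => (ENNReal.ofReal R)⁻¹ * ∫⁻ z in Metric.ball y R, H z) x

theorem measurable_hardyLittlewood (H : ℝ → ℝ≥0∞) : Measurable (hardyLittlewood H) := by
  apply LowerSemicontinuous.measurable
  unfold hardyLittlewood
  refine lowerSemicontinuous_iSup fun y => lowerSemicontinuous_iSup fun R =>
    lowerSemicontinuous_iSup fun _ => ?_
  exact Metric.isOpen_ball.lowerSemicontinuous_indicator zero_le

theorem lintegral_ball_le_hardyLittlewood (H : ℝ → ℝ≥0∞) {x y R : ℝ} (hR : 0 < R)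
    (hx : x ∈ Metric.ball y R) :
    ∫⁻ z in Metric.ball y R, H z ≤ ENNReal.ofReal R * hardyLittlewood H x := by
  have h : (ENNReal.ofReal R)⁻¹ * ∫⁻ z in Metric.ball y R, H z ≤ hardyLittlewood H x := by
    unfold hardyLittlewood
    refine le_iSup_of_le y (le_iSup_of_le R (le_iSup_of_le hR ?_))
    rw [indicator_of_mem hx]
  have h0 : ENNReal.ofReal R ≠ 0 := by simpa using hR
  calc _ = ENNReal.ofReal R * ((ENNReal.ofReal R)⁻¹ * ∫⁻ z in Metric.ball y R, H z) := by
        rw [← mul_assoc, ENNReal.mul_inv_cancel h0 ENNReal.ofReal_ne_top, one_mul]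
    _ ≤ _ := by gcongr

theorem hardyLittlewood_le_iff {H : ℝ → ℝ≥0∞} {x : ℝ} {c : ℝ≥0∞} :
    hardyLittlewood H x ≤ c ↔ ∀ y R : ℝ, x ∈ Metric.ball y R →
      ∫⁻ z in Metric.ball y R, H z ≤ ENNReal.ofReal R * c := by
  constructor
  · intro h y R hx
    have hR : 0 < R := Metric.pos_of_mem_ball hx
    exact (lintegral_ball_le_hardyLittlewood H hR hx).trans (by gcongr)
  · intro h
    refine iSup_le fun y => iSup_le fun R => iSup_le fun hR => ?_
    by_cases hx : x ∈ Metric.ball y R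
    · rw [indicator_of_mem hx, mul_comm, ← div_eq_mul_inv]
      refine ENNReal.div_le_of_le_mul ?_
      rw [mul_comm]; exact h y R hx
    · simp [hx]

theorem hardyLittlewood_le_essSup (H : ℝ → ℝ≥0∞) (x : ℝ) :
    hardyLittlewood H x ≤ 2 * essSup H volume := by
  rw [hardyLittlewood_le_iff]
  intro y R hx
  calc ∫⁻ z in Metric.ball y R, H z ≤ ∫⁻ z in Metric.ball y R, essSup H volume :=
        lintegral_mono_ae (ae_restrict_of_ae (ENNReal.ae_le_essSup H))
    _ = _ := by
      rw [setLIntegral_const, Real.volume_ball, ENNReal.ofReal_mul (by norm_num)]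
      simp; ring

theorem hardyLittlewood_add_le {H G K : ℝ → ℝ≥0∞} (hG : Measurable G) (h : ∀ z, H z ≤ G z + K z)
    (x : ℝ) : hardyLittlewood H x ≤ hardyLittlewood G x + hardyLittlewood K x := by
  rw [hardyLittlewood_le_iff]
  intro y R hx
  have hR : 0 < R := Metric.pos_of_mem_ball hx
  calc ∫⁻ z in Metric.ball y R, H z ≤ ∫⁻ z in Metric.ball y R, (G z + K z) :=
        lintegral_mono h
    _ = (∫⁻ z in Metric.ball y R, G z) + ∫⁻ z in Metric.ball y R, K z := lintegral_add_left hG _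
    _ ≤ _ := by
      rw [mul_add]
      exact add_le_add (lintegral_ball_le_hardyLittlewood G hR hx)
        (lintegral_ball_le_hardyLittlewood K hR hx)

theorem hardyLittlewood_eq_zero {H : ℝ → ℝ≥0∞} (h : H =ᵐ[volume] 0) (x : ℝ) :
    hardyLittlewood H x = 0 := by
  have := hardyLittlewood_le_essSup H x
  rw [essSup_congr_ae h, show essSup (0 : ℝ → ℝ≥0∞) volume = 0 from
    essSup_const 0 (NeZero.ne volume)] at this
  simpa using this

/-- The weak type `(1,1)` estimate. -/
theorem volume_lt_hardyLittlewood_le (H : ℝ → ℝ≥0∞) {l : ℝ} (hl : 0 < l) :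
    ENNReal.ofReal l * volume {x | ENNReal.ofReal l < hardyLittlewood H x} ≤ 10 * ∫⁻ z, H z := by
  rcases eq_or_ne (∫⁻ z, H z) ∞ with htop | hfin
  · simp [htop]
  set t : Set (ℝ × ℝ) := {b | 0 < b.2 ∧
    ENNReal.ofReal l * ENNReal.ofReal b.2 < ∫⁻ z in Metric.ball b.1 b.2, H z} with ht
  have hbound : ∀ b ∈ t, b.2 ≤ (∫⁻ z, H z).toReal / l := by
    intro b hb
    rw [le_div_iff₀ hl]
    have h1 := hb.2.le.trans (setLIntegral_le_lintegral _ _)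
    rw [← ENNReal.ofReal_mul hl.le] at h1
    have := (ENNReal.ofReal_le_iff_le_toReal hfin).1 h1
    linarith
  -- The factor 5 together with volume 2R of a ball of radius R gives the constant 10.
  obtain ⟨u, hut, hdisj, hcov⟩ := Vitali.exists_disjoint_subfamily_covering_enlargement_ball t
    (fun b => b.1) (fun b => b.2) _ hbound 5 (by norm_num)
  have hucount : u.Countable := hdisj.countable_of_isOpen (fun _ _ => Metric.isOpen_ball)
    (fun b hb => ⟨b.1, Metric.mem_ball_self (hut hb).1⟩)
  have hsub : {x | ENNReal.ofReal l < hardyLittlewood H x} ⊆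
      ⋃ b ∈ u, Metric.ball b.1 (5 * b.2) := by
    intro x hx
    have : ¬ hardyLittlewood H x ≤ ENNReal.ofReal l := not_le.2 hx
    rw [hardyLittlewood_le_iff] at this
    push Not at this
    obtain ⟨y, R, hxb, hlt⟩ := this
    obtain ⟨b, hb, hsb⟩ := hcov (y, R) ⟨Metric.pos_of_mem_ball hxb, by rwa [mul_comm]⟩
    exact mem_biUnion hb (hsb hxb)
  have := hucount.to_subtype
  calc ENNReal.ofReal l * volume {x | ENNReal.ofReal l < hardyLittlewood H x}
      ≤ ENNReal.ofReal l * ∑' b : u, volume (Metric.ball b.1.1 (5 * b.1.2)) := by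
        gcongr
        exact (measure_mono hsub).trans (measure_biUnion_le _ hucount _)
    _ = ∑' b : u, 10 * (ENNReal.ofReal l * ENNReal.ofReal b.1.2) := by
        rw [← ENNReal.tsum_mul_left]
        congr 1; ext b
        rw [Real.volume_ball, ← mul_assoc, ENNReal.ofReal_mul (by norm_num)]
        norm_num; ring
    _ ≤ ∑' b : u, 10 * ∫⁻ z in Metric.ball b.1.1 b.1.2, H z := by
        gcongr with b
        exact (hut b.2).2.le
    _ = 10 * ∫⁻ z in ⋃ b ∈ u, Metric.ball b.1 b.2, H z := by
        rw [ENNReal.tsum_mul_left, lintegral_biUnion hucount (fun _ _ => measurableSet_ball) hdisj]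
    _ ≤ 10 * ∫⁻ z, H z := by
        exact mul_le_mul_right (setLIntegral_le_lintegral _ _) _

/-- The truncated weak type estimate behind Marcinkiewicz interpolation. -/
theorem volume_three_lt_hardyLittlewood_le {H : ℝ → ℝ≥0∞} (hH : Measurable H) {l : ℝ}
    (hl : 0 < l) :
    ENNReal.ofReal l * volume {x | ENNReal.ofReal (3 * l) < hardyLittlewood H x} ≤
      10 * ∫⁻ z, {z | ENNReal.ofReal l < H z}.indicator H z := by
  set G := {z | ENNReal.ofReal l < H z}.indicator H
  have hG : Measurable G := hH.indicator (measurableSet_lt measurable_const hH)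
  have hle : ∀ z, H z ≤ G z + ENNReal.ofReal l := by
    intro z
    by_cases hz : ENNReal.ofReal l < H z
    · simp [G, hz]
    · exact (not_lt.1 hz).trans le_add_self
  refine le_trans ?_ (volume_lt_hardyLittlewood_le G hl)
  refine mul_le_mul_right (measure_mono fun x hx => ?_) _
  -- The part of `H` below height l has maximal function at most 2l, so a value above 3l leaves more
  -- than l to `G`.
  have h1 := (hardyLittlewood_add_le hG hle x).trans
    (add_le_add_right (hardyLittlewood_le_essSup _ x) _)
  rw [essSup_const _ (NeZero.ne volume)] at h1
  have h2 : ENNReal.ofReal (3 * l) = ENNReal.ofReal l + 2 * ENNReal.ofReal l := by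
    rw [ENNReal.ofReal_mul (by norm_num)]; norm_num; ring
  simp only [mem_ofPred_eq] at hx ⊢
  rw [h2] at hx
  exact lt_of_add_lt_add_right (hx.trans_le h1)

theorem lintegral_Ioo_rpow {b P : ℝ} (hb : 0 ≤ b) (hP : 0 < P) :
    ∫⁻ t in Ioo 0 b, ENNReal.ofReal (t ^ (P - 1)) = ENNReal.ofReal (b ^ P / P) := by
  have hi : IntervalIntegrable (fun t : ℝ => t ^ (P - 1)) volume 0 b :=
    intervalIntegral.intervalIntegrable_rpow' (by linarith)
  rw [restrict_Ioo_eq_restrict_Ioc,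
    ← ofReal_integral_eq_lintegral_ofReal ((intervalIntegrable_iff_integrableOn_Ioc_of_le hb).1 hi),
    ← intervalIntegral.integral_of_le hb, integral_rpow (Or.inl (by linarith))]
  · simp [Real.zero_rpow hP.ne']
  · filter_upwards [ae_restrict_mem measurableSet_Ioc] with t ht
    exact Real.rpow_nonneg ht.1.le _

theorem lintegral_indicator_rpow_le (a : ℝ≥0∞) {P : ℝ} (hP : 0 < P) :
    ∫⁻ t in Ioi 0, {t | ENNReal.ofReal t < a}.indicator (fun t => ENNReal.ofReal (t ^ (P - 1))) t
      ≤ (ENNReal.ofReal P)⁻¹ * a ^ P := by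
  rcases eq_or_ne a ∞ with rfl | ha
  · simp [hP, ENNReal.ofReal_ne_top]
  · rw [lintegral_indicator (measurableSet_lt ENNReal.measurable_ofReal measurable_const),
      Measure.restrict_restrict (measurableSet_lt ENNReal.measurable_ofReal measurable_const)]
    have : {t | ENNReal.ofReal t < a} ∩ Ioi 0 ⊆ Ioo 0 a.toReal := by
      rintro t ⟨h1, h2⟩
      exact ⟨h2, (ENNReal.ofReal_lt_iff_lt_toReal (le_of_lt h2) ha).1 h1⟩
    refine (lintegral_mono_set this).trans ?_
    rw [lintegral_Ioo_rpow ENNReal.toReal_nonneg hP, div_eq_inv_mul,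
      ENNReal.ofReal_mul (by positivity), ENNReal.ofReal_inv_of_pos hP,
      ← ENNReal.ofReal_rpow_of_nonneg ENNReal.toReal_nonneg hP.le, ENNReal.ofReal_toReal ha]

/-- Layer cake for a single value. The value ∞ is reached through its finite minorants. -/
theorem rpow_le_lintegral_indicator (a : ℝ≥0∞) {P : ℝ} (hP : 0 < P) :
    a ^ P ≤ ENNReal.ofReal P * ∫⁻ t in Ioi 0,
      {t | ENNReal.ofReal t < a}.indicator (fun t => ENNReal.ofReal (t ^ (P - 1))) t := by
  have key : ∀ b : ℝ≥0, (b : ℝ≥0∞) ≤ a → (b : ℝ≥0∞) ^ P ≤ ENNReal.ofReal P * ∫⁻ t in Ioi 0,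
      {t | ENNReal.ofReal t < a}.indicator (fun t => ENNReal.ofReal (t ^ (P - 1))) t := by
    intro b hb
    rw [lintegral_indicator (measurableSet_lt ENNReal.measurable_ofReal measurable_const),
      Measure.restrict_restrict (measurableSet_lt ENNReal.measurable_ofReal measurable_const)]
    have hs : Ioo 0 (b : ℝ) ⊆ {t | ENNReal.ofReal t < a} ∩ Ioi 0 := by
      rintro t ⟨h1, h2⟩
      refine ⟨lt_of_lt_of_le ?_ hb, h1⟩
      rw [ENNReal.ofReal, ENNReal.coe_lt_coe]
      exact (Real.toNNReal_lt_iff_lt_coe h1.le).2 h2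
    refine le_trans ?_ (mul_le_mul_right (lintegral_mono_set hs) _)
    rw [lintegral_Ioo_rpow b.coe_nonneg hP, ← ENNReal.ofReal_mul hP.le, mul_div_cancel₀ _ hP.ne',
      ← ENNReal.ofReal_rpow_of_nonneg b.coe_nonneg hP.le, ENNReal.ofReal_coe_nnreal]
  rcases eq_or_ne a ∞ with rfl | ha
  · rw [ENNReal.top_rpow_of_pos hP]
    refine le_of_eq (ENNReal.eq_top_of_forall_nnreal_le fun b => ?_).symm
    refine le_trans (le_of_eq ?_) (key (b ^ P⁻¹) le_top)
    rw [← ENNReal.coe_rpow_of_nonneg _ hP.le, ← NNReal.rpow_mul, inv_mul_cancel₀ hP.ne',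
      NNReal.rpow_one]
  · lift a to ℝ≥0 using ha
    exact key a le_rfl

/-- The Hardy–Littlewood maximal theorem. -/
theorem lintegral_hardyLittlewood_rpow_le {P : ℝ} (hP : 1 < P) :
    ∃ C : ℝ≥0, ∀ H : ℝ → ℝ≥0∞, Measurable H →
      ∫⁻ x, hardyLittlewood H x ^ P ≤ C * ∫⁻ x, H x ^ P := by
  have hP0 : 0 < P := by linarith
  have hP1 : 0 < P - 1 := by linarith
  -- The factor 3^P comes from the threshold 3t, P from the layer cake, 10 from the weak type bound,
  -- and 1/(P-1) from integrating t^{P-2} up to H(z).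
  refine ⟨(ENNReal.ofReal 3 ^ P * ENNReal.ofReal P * 10 * (ENNReal.ofReal (P - 1))⁻¹).toNNReal,
    fun H hH => ?_⟩
  rw [ENNReal.coe_toNNReal (by
    refine ENNReal.mul_ne_top (ENNReal.mul_ne_top (ENNReal.mul_ne_top ?_ ?_) ?_) ?_
    · exact ENNReal.rpow_ne_top_of_nonneg hP0.le ENNReal.ofReal_ne_top
    · exact ENNReal.ofReal_ne_top
    · norm_num
    · simpa using hP)]
  have hM := measurable_hardyLittlewood H
  set M := hardyLittlewood H
  have h3 : ENNReal.ofReal 3 ≠ 0 := by simp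
  have hdiv : ∀ x, M x ^ P = ENNReal.ofReal 3 ^ P * (M x / ENNReal.ofReal 3) ^ P := by
    intro x
    rw [← ENNReal.mul_rpow_of_nonneg _ _ hP0.le, ENNReal.mul_div_cancel h3 ENNReal.ofReal_ne_top]
  have hset : MeasurableSet {q : ℝ × ℝ | ENNReal.ofReal q.2 < M q.1 / ENNReal.ofReal 3} :=
    measurableSet_lt (by fun_prop) (by fun_prop)
  have hset' : MeasurableSet {q : ℝ × ℝ | ENNReal.ofReal q.2 < H q.1} :=
    measurableSet_lt (by fun_prop) (by fun_prop)
  have step1 : ∫⁻ x, (M x / ENNReal.ofReal 3) ^ P ≤ ENNReal.ofReal P * ∫⁻ t in Ioi (0 : ℝ),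
      ENNReal.ofReal (t ^ (P - 1)) * volume {x | ENNReal.ofReal (3 * t) < M x} := by
    calc _ ≤ ∫⁻ x, ENNReal.ofReal P * ∫⁻ t in Ioi (0 : ℝ),
          {t | ENNReal.ofReal t < M x / ENNReal.ofReal 3}.indicator
            (fun t => ENNReal.ofReal (t ^ (P - 1))) t :=
          lintegral_mono fun x => rpow_le_lintegral_indicator _ hP0
      _ = ENNReal.ofReal P * ∫⁻ x, ∫⁻ t in Ioi (0 : ℝ),
          {t | ENNReal.ofReal t < M x / ENNReal.ofReal 3}.indicator
            (fun t => ENNReal.ofReal (t ^ (P - 1))) t :=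
          lintegral_const_mul' _ _ ENNReal.ofReal_ne_top
      _ = ENNReal.ofReal P * ∫⁻ t in Ioi (0 : ℝ), ∫⁻ x,
          {t | ENNReal.ofReal t < M x / ENNReal.ofReal 3}.indicator
            (fun t => ENNReal.ofReal (t ^ (P - 1))) t := by
          rw [lintegral_lintegral_swap]
          refine Measurable.aemeasurable ?_
          exact Measurable.indicator (f := fun q : ℝ × ℝ => ENNReal.ofReal (q.2 ^ (P - 1)))
            (by fun_prop) hset
      _ ≤ _ := by
          gcongr 1
          refine lintegral_mono fun t => ?_
          have : ∀ x, {t | ENNReal.ofReal t < M x / ENNReal.ofReal 3}.indicator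
            (fun t => ENNReal.ofReal (t ^ (P - 1))) t = {x | ENNReal.ofReal (3 * t) < M x}.indicator
              (fun _ => ENNReal.ofReal (t ^ (P - 1))) x := by
            intro x
            have e : ENNReal.ofReal t < M x / ENNReal.ofReal 3 ↔
                ENNReal.ofReal (3 * t) < M x := by
              rw [ENNReal.lt_div_iff_mul_lt (Or.inl h3) (Or.inl ENNReal.ofReal_ne_top), mul_comm,
                ENNReal.ofReal_mul (by norm_num)]
            simp only [indicator, mem_ofPred_eq, e]
          simp_rw [this]
          rw [lintegral_indicator_const (measurableSet_lt measurable_const hM)]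
  have step2 : ∫⁻ t in Ioi (0 : ℝ),
      ENNReal.ofReal (t ^ (P - 1)) * volume {x | ENNReal.ofReal (3 * t) < M x} ≤
      10 * ((ENNReal.ofReal (P - 1))⁻¹ * ∫⁻ z, H z ^ P) := by
    calc _ ≤ ∫⁻ t in Ioi (0 : ℝ), 10 * ∫⁻ z, H z * {t | ENNReal.ofReal t < H z}.indicator
            (fun t => ENNReal.ofReal (t ^ (P - 1 - 1))) t := by
          refine setLIntegral_mono' measurableSet_Ioi fun t ht => ?_
          have ht0 : (0 : ℝ) < t := ht
          have hw := volume_three_lt_hardyLittlewood_le hH ht0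
          have e1 : ENNReal.ofReal (t ^ (P - 1)) =
              ENNReal.ofReal (t ^ (P - 1 - 1)) * ENNReal.ofReal t := by
            rw [← ENNReal.ofReal_mul (by positivity)]
            congr 1
            nth_rewrite 3 [← Real.rpow_one t]
            rw [← Real.rpow_add ht0]; ring_nf
          rw [e1, mul_assoc]
          refine (mul_le_mul_right hw _).trans (le_of_eq ?_)
          rw [mul_left_comm, ← lintegral_const_mul' _ _ ENNReal.ofReal_ne_top]
          congr 2; ext z
          by_cases hz : ENNReal.ofReal t < H z <;> simp [indicator, hz, mul_comm]
      _ = 10 * ∫⁻ z, ∫⁻ t in Ioi (0 : ℝ), H z * {t | ENNReal.ofReal t < H z}.indicator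
            (fun t => ENNReal.ofReal (t ^ (P - 1 - 1))) t := by
          rw [lintegral_const_mul' _ _ (by norm_num), lintegral_lintegral_swap]
          refine Measurable.aemeasurable ?_
          refine Measurable.mul (by fun_prop) ?_
          refine Measurable.indicator (f := fun q : ℝ × ℝ => ENNReal.ofReal (q.1 ^ (P - 1 - 1)))
            (by fun_prop) (s := {q : ℝ × ℝ | ENNReal.ofReal q.1 < H q.2}) ?_
          exact measurableSet_lt (by fun_prop) (by fun_prop)
      _ ≤ 10 * ∫⁻ z, (ENNReal.ofReal (P - 1))⁻¹ * H z ^ P := by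
          gcongr with z
          rw [lintegral_const_mul _ (Measurable.indicator (by fun_prop)
            (measurableSet_lt (by fun_prop) (by fun_prop)))]
          refine (mul_le_mul_right (lintegral_indicator_rpow_le (H z) hP1) _).trans (le_of_eq ?_)
          rw [mul_left_comm]
          congr 1
          nth_rewrite 1 [← ENNReal.rpow_one (H z)]
          rw [← ENNReal.rpow_add_of_nonneg _ _ zero_le_one hP1.le]; ring_nf
      _ = _ := by
          rw [lintegral_const_mul' _ _ (by simpa using hP)]
  simp_rw [hdiv]
  rw [lintegral_const_mul' _ _ (ENNReal.rpow_ne_top_of_nonneg hP0.le ENNReal.ofReal_ne_top)]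
  calc _ ≤ ENNReal.ofReal 3 ^ P * (ENNReal.ofReal P *
        (10 * ((ENNReal.ofReal (P - 1))⁻¹ * ∫⁻ z, H z ^ P))) := by
        gcongr; exact step1.trans (by gcongr)
    _ = _ := by ring

/-! ### Dilated averages and norm inequalities -/

/-- The substitution v = x - tu has Jacobian t and multiplies the radius by t; the two cancel. This
is the source of all uniformity in t₁ and t₂. -/
theorem lintegral_ball_comp_le (H : ℝ → ℝ≥0∞) (x : ℝ) {t ρ : ℝ} (ht : 0 < t) (hρ : 0 < ρ) :
    ∫⁻ u in Metric.ball 0 ρ, H (x - t * u) ≤ ENNReal.ofReal ρ * hardyLittlewood H x := by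
  have h := lintegral_image_eq_lintegral_abs_deriv_mul (s := Metric.ball (0 : ℝ) ρ)
    (f := fun u => x - t * u) (f' := fun _ => -t) measurableSet_ball
    (fun u _ => by
      simpa using ((hasDerivAt_id u).const_mul t).const_sub x |>.hasDerivWithinAt)
    (fun u _ v _ huv => by simpa [ht.ne'] using huv) H
  have himg : (fun u => x - t * u) '' Metric.ball (0 : ℝ) ρ ⊆ Metric.ball x (t * ρ) := by
    rintro _ ⟨u, hu, rfl⟩
    simp only [Metric.mem_ball, dist_zero_right, Real.norm_eq_abs, Real.dist_eq] at hu ⊢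
    rw [show x - t * u - x = -(t * u) by ring, abs_neg, abs_mul, abs_of_pos ht]
    gcongr
  rw [lintegral_const_mul' _ _ ENNReal.ofReal_ne_top, abs_neg, abs_of_pos ht] at h
  have h2 := (h.symm.trans_le (lintegral_mono_set himg)).trans
    (lintegral_ball_le_hardyLittlewood H (by positivity)
      (Metric.mem_ball_self (by positivity)))
  rw [ENNReal.ofReal_mul ht.le, mul_assoc] at h2
  exact (ENNReal.mul_le_mul_iff_right (by simpa using ht) ENNReal.ofReal_ne_top).1 h2

theorem exists_dyadic_ball {K u : ℝ} (hu0 : u ≠ 0) (hu : |u| < K) :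
    ∃ j : ℕ, |u| < K * (1 / 2) ^ j ∧ K * (1 / 2) ^ (j + 1) ≤ |u| := by
  have hK : 0 < K := (abs_nonneg u).trans_lt hu
  have h : ∃ j : ℕ, K * (1 / 2 : ℝ) ^ j ≤ |u| := by
    obtain ⟨n, hn⟩ := exists_pow_lt_of_lt_one (div_pos (abs_pos.2 hu0) hK)
      (by norm_num : (1 / 2 : ℝ) < 1)
    refine ⟨n, ?_⟩
    rw [lt_div_iff₀ hK] at hn
    linarith
  classical
  have h0 : Nat.find h ≠ 0 := by
    intro h0
    have := Nat.find_spec h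
    rw [h0] at this
    simp at this
    linarith
  obtain ⟨j, hj⟩ := Nat.exists_eq_succ_of_ne_zero h0
  refine ⟨j, not_le.1 (Nat.find_min h (by omega)), ?_⟩
  have := Nat.find_spec h
  rwa [hj] at this

/-- Averages against the integrable radial kernels `|u|^{-β}` are controlled by the maximal
function, uniformly in the dilation. -/
theorem lintegral_radial_le {β : ℝ} (hβ : 0 ≤ β) (hβ1 : β < 1) {K : ℝ} (hK : 0 < K) :
    ∃ C : ℝ≥0, ∀ H : ℝ → ℝ≥0∞, Measurable H → ∀ x t : ℝ, 0 < t →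
      ∫⁻ u in Metric.ball 0 K, ENNReal.ofReal (|u| ^ (-β)) * H (x - t * u) ≤
        C * hardyLittlewood H x := by
  -- The shell |u| ≈ K 2^{-j} costs (K 2^{-j-1})^{-β} · K 2^{-j} = c ρ^j, and β < 1 makes the series
  -- geometric with ρ < 1.
  set c : ℝ≥0∞ := ENNReal.ofReal ((K / 2) ^ (-β) * K)
  set ρ : ℝ≥0∞ := ENNReal.ofReal ((1 / 2 : ℝ) ^ (1 - β))
  have hρ1 : ρ < 1 := by
    rw [← ENNReal.ofReal_one]
    exact (ENNReal.ofReal_lt_ofReal_iff one_pos).2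
      (Real.rpow_lt_one (by norm_num) (by norm_num) (by linarith))
  have hCfin : c * (1 - ρ)⁻¹ ≠ ⊤ :=
    ENNReal.mul_ne_top ENNReal.ofReal_ne_top (ENNReal.inv_ne_top.2 (tsub_pos_of_lt hρ1).ne')
  refine ⟨(c * (1 - ρ)⁻¹).toNNReal, fun H hH x t ht => ?_⟩
  rw [ENNReal.coe_toNNReal hCfin]
  have hpt : ∀ᵐ u ∂(volume.restrict (Metric.ball (0 : ℝ) K)),
      ENNReal.ofReal (|u| ^ (-β)) * H (x - t * u) ≤
      ∑' j : ℕ, ENNReal.ofReal ((K * (1 / 2) ^ (j + 1)) ^ (-β)) *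
        (Metric.ball (0 : ℝ) (K * (1 / 2) ^ j)).indicator (fun u => H (x - t * u)) u := by
    filter_upwards [ae_restrict_mem measurableSet_ball,
      ae_restrict_of_ae (Measure.ae_ne volume (0 : ℝ))] with u hu hu0
    obtain ⟨j, hj1, hj2⟩ := exists_dyadic_ball hu0 (by simpa using hu)
    refine le_trans ?_ (ENNReal.le_tsum j)
    rw [indicator_of_mem (by simpa using hj1)]
    exact mul_le_mul_left (ENNReal.ofReal_le_ofReal
      (Real.rpow_le_rpow_of_nonpos (by positivity) hj2 (neg_nonpos.2 hβ))) _
  calc _ ≤ ∫⁻ u in Metric.ball 0 K, ∑' j : ℕ, ENNReal.ofReal ((K * (1 / 2) ^ (j + 1)) ^ (-β)) *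
        (Metric.ball (0 : ℝ) (K * (1 / 2) ^ j)).indicator (fun u => H (x - t * u)) u :=
        lintegral_mono_ae hpt
    _ ≤ ∫⁻ u, ∑' j : ℕ, ENNReal.ofReal ((K * (1 / 2) ^ (j + 1)) ^ (-β)) *
        (Metric.ball (0 : ℝ) (K * (1 / 2) ^ j)).indicator (fun u => H (x - t * u)) u :=
        setLIntegral_le_lintegral _ _
    _ = ∑' j : ℕ, ENNReal.ofReal ((K * (1 / 2) ^ (j + 1)) ^ (-β)) *
        ∫⁻ u in Metric.ball (0 : ℝ) (K * (1 / 2) ^ j), H (x - t * u) := by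
        rw [lintegral_tsum]
        · congr 1; ext j
          rw [lintegral_const_mul' _ _ ENNReal.ofReal_ne_top, lintegral_indicator measurableSet_ball]
        · intro j
          refine Measurable.aemeasurable (Measurable.const_mul (Measurable.indicator ?_
            measurableSet_ball) _)
          fun_prop
    _ ≤ ∑' j : ℕ, c * ρ ^ j * hardyLittlewood H x := by
        refine ENNReal.tsum_le_tsum fun j => ?_
        refine (mul_le_mul_right (lintegral_ball_comp_le H x ht (ρ := K * (1 / 2) ^ j)
          (by positivity)) _).trans
          (le_of_eq ?_)
        rw [← mul_assoc, ← ENNReal.ofReal_pow (by positivity),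
          ← ENNReal.ofReal_mul (by positivity), ← ENNReal.ofReal_mul (by positivity)]
        congr 2
        have e2 : ((1 / 2 : ℝ) ^ j) ^ (-β) = ((1 / 2 : ℝ) ^ (-β)) ^ j := by
          rw [← Real.rpow_natCast_mul (by norm_num), mul_comm, Real.rpow_mul_natCast (by norm_num)]
        have e3 : (1 / 2 : ℝ) ^ (1 - β) = 1 / 2 * (1 / 2 : ℝ) ^ (-β) := by
          rw [sub_eq_add_neg, Real.rpow_add (by norm_num), Real.rpow_one]
        rw [show K * (1 / 2 : ℝ) ^ (j + 1) = K / 2 * (1 / 2) ^ j by ring,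
          Real.mul_rpow (by positivity) (by positivity), e2, e3, mul_pow]
        ring
    _ = _ := by
        rw [ENNReal.tsum_mul_right, ENNReal.tsum_mul_left, ENNReal.tsum_geometric]

/-- The maximal function of the power `1/a` of a function, to the power `a`, is bounded on `L^p`
for `p⁻¹ < a`. -/
theorem eLpNorm_hardyLittlewood_rpow_le {a : ℝ} (ha : 0 < a) {p : ℝ≥0∞} (hp0 : 0 < p)
    (hp : p⁻¹ < ENNReal.ofReal a) :
    ∃ C : ℝ≥0, ∀ F : ℝ → ℝ≥0∞, Measurable F →
      eLpNorm (fun x => hardyLittlewood (fun y => F y ^ (1 / a)) x ^ a) p volume ≤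
        C * eLpNorm F p volume := by
  rcases eq_or_ne p ⊤ with rfl | hptop
  · refine ⟨((2 : ℝ≥0∞) ^ a).toNNReal, fun F hF => ?_⟩
    rw [ENNReal.coe_toNNReal (ENNReal.rpow_ne_top_of_nonneg ha.le (by norm_num)),
      eLpNorm_exponent_top, eLpNorm_exponent_top]
    refine eLpNormEssSup_le_of_ae_enorm_bound (ae_of_all _ fun x => ?_)
    rw [enorm_eq_self]
    have h : essSup (fun y => F y ^ (1 / a)) volume ≤ eLpNormEssSup F volume ^ (1 / a) := by
      refine essSup_le_of_ae_le _ ?_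
      filter_upwards [ae_le_eLpNormEssSup (f := F) (μ := volume)] with y hy
      rw [enorm_eq_self] at hy
      gcongr
    calc _ ≤ (2 * eLpNormEssSup F volume ^ (1 / a)) ^ a := by
          gcongr
          exact (hardyLittlewood_le_essSup _ x).trans (by gcongr)
      _ = _ := by
          rw [ENNReal.mul_rpow_of_nonneg _ _ ha.le, ← ENNReal.rpow_mul, one_div,
            inv_mul_cancel₀ ha.ne', ENNReal.rpow_one]
  · have hpr : 0 < p.toReal := ENNReal.toReal_pos hp0.ne' hptop
    have hap : 1 < a * p.toReal := by
      have h1 : p⁻¹ = ENNReal.ofReal (p.toReal)⁻¹ := by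
        rw [ENNReal.ofReal_inv_of_pos hpr, ENNReal.ofReal_toReal hptop]
      rw [h1, ENNReal.ofReal_lt_ofReal_iff ha] at hp
      calc (1 : ℝ) = (p.toReal)⁻¹ * p.toReal := by field_simp
        _ < _ := by gcongr
    -- The L^{ap} norm of F^{1/a}, raised to the power a, is the L^p norm of F.
    obtain ⟨C, hC⟩ := lintegral_hardyLittlewood_rpow_le hap
    refine ⟨C ^ (1 / p.toReal), fun F hF => ?_⟩
    have := hC (fun y => F y ^ (1 / a)) (by fun_prop)
    simp_rw [ENNReal.rpow_mul _ a, ← ENNReal.rpow_mul _ (1 / a) a, one_div,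
      inv_mul_cancel₀ ha.ne', ENNReal.rpow_one] at this
    rw [eLpNorm_eq_lintegral_rpow_enorm_toReal hp0.ne' hptop,
      eLpNorm_eq_lintegral_rpow_enorm_toReal hp0.ne' hptop]
    simp_rw [enorm_eq_self]
    rw [ENNReal.coe_rpow_of_nonneg _ (by positivity),
      ← ENNReal.mul_rpow_of_nonneg _ _ (by positivity)]
    simp only [one_div] at this ⊢
    gcongr

/-- Hölder's inequality for functions with values in `[0, ∞]`. -/
theorem eLpNorm_mul_le_of_ennreal {p q r : ℝ≥0∞}
    (hr : r⁻¹ = p⁻¹ + q⁻¹) {A B : ℝ → ℝ≥0∞} (hA : Measurable A) (hB : Measurable B)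
    (hAt : ∀ᵐ x, A x ≠ ⊤) (hBt : ∀ᵐ x, B x ≠ ⊤) :
    eLpNorm (fun x => A x * B x) r volume ≤ eLpNorm A p volume * eLpNorm B q volume := by
  have : ENNReal.HolderTriple p q r := ⟨hr.symm⟩
  have e : ∀ {D : ℝ → ℝ≥0∞} {s : ℝ≥0∞}, (∀ᵐ x, D x ≠ ⊤) →
      eLpNorm (fun x => (D x).toReal) s volume = eLpNorm D s volume := by
    intro D s hD
    refine eLpNorm_congr_enorm_ae ?_
    filter_upwards [hD] with x hx
    rw [enorm_eq_self, Real.enorm_of_nonneg ENNReal.toReal_nonneg, ENNReal.ofReal_toReal hx]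
  rw [← e hAt, ← e hBt]
  refine le_trans (le_of_eq ?_) (eLpNorm_smul_le_mul_eLpNorm (p := p) (q := q) (r := r)
    (hB.ennreal_toReal.aestronglyMeasurable) (hA.ennreal_toReal.aestronglyMeasurable))
  refine eLpNorm_congr_enorm_ae ?_
  filter_upwards [hAt, hBt] with x h1 h2
  simp only [Pi.smul_apply', smul_eq_mul, enorm_eq_self]
  rw [← ENNReal.toReal_mul, Real.enorm_of_nonneg ENNReal.toReal_nonneg,
    ENNReal.ofReal_toReal (ENNReal.mul_ne_top h1 h2)]

/-! ### Reduction to weights by Hölder's inequality -/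

/-- The averages of `H` along `φ` over `S` with weight `V` are dominated by the maximal function,
uniformly in the dilation. -/
def DominatedAverages (S : Set ℝ) (φ : ℝ → ℝ) (V : ℝ → ℝ≥0∞) : Prop :=
  ∃ C : ℝ≥0, ∀ H : ℝ → ℝ≥0∞, Measurable H → ∀ x t : ℝ, 0 < t →
    ∫⁻ s in S, V s * H (x - t * φ s) ≤ C * hardyLittlewood H x

/-- Domination applied to the indicator of a measurable null set containing `N`, whose maximal
function is zero. It allows f and g to be replaced by measurable representatives along the curve,
for every x and every dilation. -/
theorem DominatedAverages.ae_notMem {S : Set ℝ} {φ : ℝ → ℝ} {V : ℝ → ℝ≥0∞}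
    (h : DominatedAverages S φ V) (hφ : AEMeasurable φ (volume.restrict S)) (hV : Measurable V)
    (hV0 : ∀ᵐ s ∂(volume.restrict S), V s ≠ 0) {N : Set ℝ} (hN : volume N = 0) {x t : ℝ}
    (ht : 0 < t) : ∀ᵐ s ∂(volume.restrict S), x - t * φ s ∉ N := by
  obtain ⟨C, hC⟩ := h
  set N' := toMeasurable volume N
  have hN' : MeasurableSet N' := measurableSet_toMeasurable _ _
  have hm : Measurable (N'.indicator (fun _ => (1 : ℝ≥0∞))) := measurable_const.indicator hN'
  have h1 := hC _ hm x t ht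
  have hz : N'.indicator (fun _ => (1 : ℝ≥0∞)) =ᵐ[volume] 0 := by
    refine indicator_meas_zero ?_
    rw [measure_toMeasurable, hN]
  rw [hardyLittlewood_eq_zero hz, mul_zero, nonpos_iff_eq_zero, lintegral_eq_zero_iff'] at h1
  · filter_upwards [h1, hV0] with s hs hs0 hmem
    have : x - t * φ s ∈ N' := subset_toMeasurable _ _ hmem
    simp [indicator_of_mem this, hs0] at hs
  · exact hV.aemeasurable.mul (hm.comp_aemeasurable (by fun_prop))

section Weights

variable {γ : ℝ → ℝ × ℝ} {ψ : ℝ → ℝ} {S : Set ℝ} {V₁ V₂ V₃ : ℝ → ℝ≥0∞} {a b c : ℝ}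

theorem ae_ne_zero_of_weights (ha : 0 < a) (hb : 0 < b)
    (hV : ∀ᵐ s ∂(volume.restrict S), 1 ≤ V₁ s ^ a * V₂ s ^ b * V₃ s ^ c) :
    (∀ᵐ s ∂(volume.restrict S), V₁ s ≠ 0) ∧ ∀ᵐ s ∂(volume.restrict S), V₂ s ≠ 0 := by
  constructor <;> filter_upwards [hV] with s hs h0
  · rw [h0, ENNReal.zero_rpow_of_pos ha] at hs; simp at hs
  · rw [h0, ENNReal.zero_rpow_of_pos hb] at hs; simp at hs

/-- Hölder with exponents a, b, c applied to V₁|f₀|^{1/a}, V₂|g₀|^{1/b} and V₃; the lower bound on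
the weights pays for inserting them. The right side does not depend on t₁, t₂. -/
theorem lintegral_enorm_bilinearIntegrand_le (hS : MeasurableSet S) {Ψ : ℝ≥0}
    (hψ : ∀ s, ‖ψ s‖ₑ ≤ Ψ) (hψS : ∀ s ∉ S, ψ s = 0)
    (hγ₁ : AEMeasurable (fun s => (γ s).1) (volume.restrict S))
    (hγ₂ : AEMeasurable (fun s => (γ s).2) (volume.restrict S))
    (ha : 0 < a) (hb : 0 < b) (hc : 0 < c) (habc : a + b + c = 1)
    (hV₁ : Measurable V₁) (hV₂ : Measurable V₂) (hV₃ : Measurable V₃)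
    (hV : ∀ᵐ s ∂(volume.restrict S), 1 ≤ V₁ s ^ a * V₂ s ^ b * V₃ s ^ c)
    (h₁ : DominatedAverages S (fun s => (γ s).1) V₁)
    (h₂ : DominatedAverages S (fun s => (γ s).2) V₂)
    (h₃ : ∫⁻ s in S, V₃ s ≠ ⊤) :
    ∃ D : ℝ≥0, ∀ f g f₀ g₀ : ℝ → ℂ, f =ᵐ[volume] f₀ → g =ᵐ[volume] g₀ → Measurable f₀ →
      Measurable g₀ → ∀ x t₁ t₂ : ℝ, 0 < t₁ → 0 < t₂ →
      ∫⁻ s, ‖bilinearIntegrand γ ψ f g t₁ t₂ x s‖ₑ ≤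
        D * (hardyLittlewood (fun y => ‖f₀ y‖ₑ ^ (1 / a)) x ^ a *
          hardyLittlewood (fun y => ‖g₀ y‖ₑ ^ (1 / b)) x ^ b) := by
  obtain ⟨hV₁0, hV₂0⟩ := ae_ne_zero_of_weights ha hb hV
  have h₁' := h₁
  have h₂' := h₂
  obtain ⟨C₁, hC₁⟩ := h₁'
  obtain ⟨C₂, hC₂⟩ := h₂'
  set I₃ := ∫⁻ s in S, V₃ s
  refine ⟨Ψ * (C₁ ^ a * C₂ ^ b * (I₃.toNNReal) ^ c), ?_⟩
  intro f g f₀ g₀ hf hg hf₀ hg₀ x t₁ t₂ ht₁ ht₂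
  set F : ℝ → ℝ≥0∞ := fun y => ‖f₀ y‖ₑ ^ (1 / a) with hFdef
  set G : ℝ → ℝ≥0∞ := fun y => ‖g₀ y‖ₑ ^ (1 / b) with hGdef
  have hF : Measurable F := by fun_prop
  have hG : Measurable G := by fun_prop
  have hfa := h₁.ae_notMem hγ₁ hV₁ hV₁0 (N := {y | ¬ f y = f₀ y}) hf (x := x) ht₁
  have hga := h₂.ae_notMem hγ₂ hV₂ hV₂0 (N := {y | ¬ g y = g₀ y}) hg (x := x) ht₂
  let w : Fin 3 → ℝ → ℝ≥0∞ := ![fun s => V₁ s * F (x - t₁ * (γ s).1),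
    fun s => V₂ s * G (x - t₂ * (γ s).2), V₃]
  let e : Fin 3 → ℝ := ![a, b, c]
  have hsupp : ∀ s, ‖bilinearIntegrand γ ψ f g t₁ t₂ x s‖ₑ =
      S.indicator (fun s => ‖bilinearIntegrand γ ψ f g t₁ t₂ x s‖ₑ) s := by
    intro s
    by_cases hs : s ∈ S
    · rw [indicator_of_mem hs]
    · rw [indicator_of_notMem hs]; simp [bilinearIntegrand, hψS s hs]
  have hpt : ∀ᵐ s ∂(volume.restrict S), ‖bilinearIntegrand γ ψ f g t₁ t₂ x s‖ₑ ≤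
      Ψ * ∏ i, w i s ^ e i := by
    filter_upwards [hfa, hga, hV] with s h1 h2 h3
    simp only [not_not] at h1 h2
    rw [bilinearIntegrand, enorm_mul, enorm_mul, h1, h2, mul_comm]
    have hψ' : ‖(ψ s : ℂ)‖ₑ ≤ Ψ := by
      refine le_trans (le_of_eq ?_) (hψ s)
      rw [← ofReal_norm, ← ofReal_norm, Complex.norm_real]
    refine mul_le_mul' hψ' ?_
    simp only [Fin.prod_univ_three, w, e, Matrix.cons_val_zero, Matrix.cons_val_one,
      Matrix.cons_val]
    rw [ENNReal.mul_rpow_of_nonneg _ _ ha.le, ENNReal.mul_rpow_of_nonneg _ _ hb.le, hFdef, hGdef]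
    simp only
    rw [← ENNReal.rpow_mul, ← ENNReal.rpow_mul, one_div_mul_cancel ha.ne',
      one_div_mul_cancel hb.ne', ENNReal.rpow_one, ENNReal.rpow_one]
    calc _ = 1 * (‖f₀ (x - t₁ * (γ s).1)‖ₑ * ‖g₀ (x - t₂ * (γ s).2)‖ₑ) := (one_mul _).symm
      _ ≤ (V₁ s ^ a * V₂ s ^ b * V₃ s ^ c) *
          (‖f₀ (x - t₁ * (γ s).1)‖ₑ * ‖g₀ (x - t₂ * (γ s).2)‖ₑ) := by gcongr
      _ = _ := by ring
  have hw : ∀ i ∈ Finset.univ, AEMeasurable (w i) (volume.restrict S) := by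
    intro i _
    fin_cases i
    · exact hV₁.aemeasurable.mul (hF.comp_aemeasurable (by fun_prop))
    · exact hV₂.aemeasurable.mul (hG.comp_aemeasurable (by fun_prop))
    · exact hV₃.aemeasurable
  have hhold := ENNReal.lintegral_prod_norm_pow_le (μ := volume.restrict S) Finset.univ hw
    (p := e) (by simp [Fin.sum_univ_three, e, habc])
    (by intro i _; fin_cases i <;> simp [e, ha.le, hb.le, hc.le])
  calc _ = ∫⁻ s in S, ‖bilinearIntegrand γ ψ f g t₁ t₂ x s‖ₑ := by
        rw [← lintegral_indicator hS]; exact lintegral_congr hsupp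
    _ ≤ ∫⁻ s in S, Ψ * ∏ i, w i s ^ e i := lintegral_mono_ae hpt
    _ = Ψ * ∫⁻ s in S, ∏ i, w i s ^ e i := lintegral_const_mul' _ _ ENNReal.coe_ne_top
    _ ≤ Ψ * ∏ i, (∫⁻ s in S, w i s) ^ e i := by gcongr
    _ ≤ Ψ * ((C₁ * hardyLittlewood F x) ^ a * (C₂ * hardyLittlewood G x) ^ b * I₃ ^ c) := by
        simp only [Fin.prod_univ_three, w, e, Matrix.cons_val_zero, Matrix.cons_val_one,
          Matrix.cons_val]
        gcongr
        · exact hC₁ F hF x t₁ ht₁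
        · exact hC₂ G hG x t₂ ht₂
    _ = _ := by
        rw [ENNReal.mul_rpow_of_nonneg _ _ ha.le, ENNReal.mul_rpow_of_nonneg _ _ hb.le]
        push_cast
        rw [ENNReal.coe_rpow_of_nonneg _ ha.le, ENNReal.coe_rpow_of_nonneg _ hb.le,
          ENNReal.coe_rpow_of_nonneg _ hc.le, ENNReal.coe_toNNReal h₃]
        ring

theorem maximalEstimate_and_averagesConverge_of_weights (hS : MeasurableSet S)
    (hψc : Continuous ψ) (hψs : HasCompactSupport ψ) (hψS : ∀ s ∉ S, ψ s = 0)
    (hγ₁ : AEMeasurable (fun s => (γ s).1) (volume.restrict S))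
    (hγ₂ : AEMeasurable (fun s => (γ s).2) (volume.restrict S))
    (ha : 0 < a) (hb : 0 < b) (hc : 0 < c) (habc : a + b + c = 1)
    (hV₁ : Measurable V₁) (hV₂ : Measurable V₂) (hV₃ : Measurable V₃)
    (hV : ∀ᵐ s ∂(volume.restrict S), 1 ≤ V₁ s ^ a * V₂ s ^ b * V₃ s ^ c)
    (h₁ : DominatedAverages S (fun s => (γ s).1) V₁)
    (h₂ : DominatedAverages S (fun s => (γ s).2) V₂)
    (h₃ : ∫⁻ s in S, V₃ s ≠ ⊤) {p q r : ℝ≥0∞} (hp0 : 0 < p) (hq0 : 0 < q)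
    (hr : r⁻¹ = p⁻¹ + q⁻¹) (hpa : p⁻¹ < ENNReal.ofReal a) (hqb : q⁻¹ < ENNReal.ofReal b) :
    MaximalEstimate γ ψ p q r ∧ AveragesConverge γ ψ p q := by
  obtain ⟨B, hB⟩ := hψc.bounded_above_of_compact_support hψs
  have hψ : ∀ s, ‖ψ s‖ₑ ≤ (B.toNNReal : ℝ≥0∞) := fun s => by
    rw [← ofReal_norm]; exact ENNReal.ofReal_le_ofReal (hB s)
  obtain ⟨D, hD⟩ := lintegral_enorm_bilinearIntegrand_le hS hψ hψS hγ₁ hγ₂ ha hb hc habc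
    hV₁ hV₂ hV₃ hV h₁ h₂ h₃
  obtain ⟨Cp, hCp⟩ := eLpNorm_hardyLittlewood_rpow_le ha hp0 hpa
  obtain ⟨Cq, hCq⟩ := eLpNorm_hardyLittlewood_rpow_le hb hq0 hqb
  have meas : ∀ {f₀ : ℝ → ℂ} {e : ℝ},
      Measurable fun x => hardyLittlewood (fun y => ‖f₀ y‖ₑ ^ (1 / e)) x ^ e := fun {f₀ e} =>
    (measurable_hardyLittlewood _).pow_const e
  -- A finite norm makes the majorants finite almost everywhere, as both Hölder in x and absolute
  -- convergence require.
  have fin : ∀ {s : ℝ≥0∞} {e : ℝ} {C : ℝ≥0} {f f₀ : ℝ → ℂ}, 0 < s → f =ᵐ[volume] f₀ →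
      MemLp f s volume →
      eLpNorm (fun x => hardyLittlewood (fun y => ‖f₀ y‖ₑ ^ (1 / e)) x ^ e) s volume ≤
        C * eLpNorm (fun y => ‖f₀ y‖ₑ) s volume →
      (eLpNorm (fun x => hardyLittlewood (fun y => ‖f₀ y‖ₑ ^ (1 / e)) x ^ e) s volume ≤
        C * eLpNorm f s volume) ∧
      ∀ᵐ x, hardyLittlewood (fun y => ‖f₀ y‖ₑ ^ (1 / e)) x ^ e ≠ ⊤ := by
    intro s e C f f₀ hs hff hf hle
    rw [eLpNorm_enorm, eLpNorm_congr_ae hff.symm] at hle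
    refine ⟨hle, ?_⟩
    have hlt := hle.trans_lt (ENNReal.mul_lt_top ENNReal.coe_lt_top hf.2)
    rcases eq_or_ne s ⊤ with rfl | hst
    · rw [eLpNorm_exponent_top] at hlt
      filter_upwards [ae_le_eLpNormEssSup (μ := volume)
        (f := fun x => hardyLittlewood (fun y => ‖f₀ y‖ₑ ^ (1 / e)) x ^ e)] with x hx
      exact (hx.trans_lt hlt).ne
    · have := lintegral_rpow_enorm_lt_top_of_eLpNorm_lt_top hs.ne' hst hlt
      filter_upwards [ae_lt_top (Measurable.pow_const (by simpa using meas) _) this.ne] with x hx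
      intro h
      rw [h, enorm_eq_self, ENNReal.top_rpow_of_pos (ENNReal.toReal_pos hs.ne' hst)] at hx
      exact lt_irrefl _ hx
  obtain ⟨hV₁0, hV₂0⟩ := ae_ne_zero_of_weights ha hb hV
  constructor
  · refine ⟨D * (Cp * Cq), fun f g hf hg => ?_⟩
    have hf₀ := hf.1.stronglyMeasurable_mk.measurable
    have hg₀ := hg.1.stronglyMeasurable_mk.measurable
    have hfe := hf.1.ae_eq_mk
    have hge := hg.1.ae_eq_mk
    set f₀ := hf.1.mk f
    set g₀ := hg.1.mk g
    obtain ⟨hA, hA'⟩ := fin hp0 hfe hf (hCp _ hf₀.enorm)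
    obtain ⟨hB, hB'⟩ := fin hq0 hge hg (hCq _ hg₀.enorm)
    set A := fun x => hardyLittlewood (fun y => ‖f₀ y‖ₑ ^ (1 / a)) x ^ a
    set B := fun x => hardyLittlewood (fun y => ‖g₀ y‖ₑ ^ (1 / b)) x ^ b
    have hM : ∀ x, bilinearMaximal γ ψ f g x ≤ D * (A x * B x) := by
      intro x
      refine iSup_le fun t₁ => iSup_le fun ht₁ => iSup_le fun t₂ => iSup_le fun ht₂ => ?_
      exact (enorm_integral_le_lintegral_enorm _).trans
        (hD f g f₀ g₀ hfe hge hf₀ hg₀ x t₁ t₂ ht₁ ht₂)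
    calc eLpNorm (bilinearMaximal γ ψ f g) r volume
        ≤ D * eLpNorm (fun x => A x * B x) r volume := by
          refine eLpNorm_le_nnreal_smul_eLpNorm_of_ae_le_mul' (ae_of_all _ fun x => ?_) r
          simpa only [enorm_eq_self] using hM x
      _ ≤ D * ((Cp * eLpNorm f p volume) * (Cq * eLpNorm g q volume)) := by
          gcongr
          exact (eLpNorm_mul_le_of_ennreal hr meas meas hA' hB').trans (mul_le_mul' hA hB)
      _ = _ := by push_cast; ring
  · intro f g hf hg
    have hf₀ := hf.1.stronglyMeasurable_mk.measurable
    have hg₀ := hg.1.stronglyMeasurable_mk.measurable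
    have hfe := hf.1.ae_eq_mk
    have hge := hg.1.ae_eq_mk
    set f₀ := hf.1.mk f
    set g₀ := hg.1.mk g
    obtain ⟨-, hA'⟩ := fin hp0 hfe hf (hCp _ hf₀.enorm)
    obtain ⟨-, hB'⟩ := fin hq0 hge hg (hCq _ hg₀.enorm)
    filter_upwards [hA', hB'] with x hx1 hx2 t₁ t₂ ht₁ ht₂
    refine ⟨?_, (hD f g f₀ g₀ hfe hge hf₀ hg₀ x t₁ t₂ ht₁ ht₂).trans_lt
      (ENNReal.mul_lt_top ENNReal.coe_lt_top
        (ENNReal.mul_lt_top (lt_top_iff_ne_top.2 hx1) (lt_top_iff_ne_top.2 hx2)))⟩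
    have hind : bilinearIntegrand γ ψ f g t₁ t₂ x =
        S.indicator (bilinearIntegrand γ ψ f g t₁ t₂ x) := by
      ext s
      by_cases hs : s ∈ S
      · rw [indicator_of_mem hs]
      · rw [indicator_of_notMem hs]; simp [bilinearIntegrand, hψS s hs]
    rw [hind, aestronglyMeasurable_indicator_iff hS]
    have hfa := h₁.ae_notMem hγ₁ hV₁ hV₁0 (N := {y | ¬ f y = f₀ y}) hfe (x := x) ht₁
    have hga := h₂.ae_notMem hγ₂ hV₂ hV₂0 (N := {y | ¬ g y = g₀ y}) hge (x := x) ht₂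
    refine AEStronglyMeasurable.congr (f := bilinearIntegrand γ ψ f₀ g₀ t₁ t₂ x) ?_ ?_
    · refine AEMeasurable.aestronglyMeasurable ?_
      refine ((hf₀.comp_aemeasurable (by fun_prop)).mul (hg₀.comp_aemeasurable (by fun_prop))).mul
        ?_
      exact (Complex.measurable_ofReal.comp hψc.measurable).aemeasurable
    · filter_upwards [hfa, hga] with s h1 h2
      simp only [not_not] at h1 h2
      simp only [bilinearIntegrand, h1, h2]

end Weights

/-! ### Averages along a component of finite type -/

/-- Quantitative form of finite type `m` at `s₀`, on the interval of radius `ε` around `s₀`. -/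
structure FiniteTypeOn (m : ℕ) (h dh : ℝ → ℝ) (s₀ ε c C : ℝ) : Prop where
  radius_pos : 0 < ε
  lower_pos : 0 < c
  upper_pos : 0 < C
  hasDerivAt : ∀ s, |s - s₀| < ε → HasDerivAt h (dh s) s
  lower : ∀ s, |s - s₀| < ε → c * |s - s₀| ^ (m - 1) ≤ |dh s|
  upper : ∀ s, |s - s₀| < ε → |h s - h s₀| ≤ C * |s - s₀| ^ m

theorem DominatedAverages.congr {S : Set ℝ} (hS : MeasurableSet S) {φ φ' : ℝ → ℝ}
    {V : ℝ → ℝ≥0∞} (h : DominatedAverages S φ V) (hφ : ∀ s ∈ S, φ' s = φ s) :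
    DominatedAverages S φ' V := by
  obtain ⟨C, hC⟩ := h
  refine ⟨C, fun H hH x t ht => (le_of_eq ?_).trans (hC H hH x t ht)⟩
  exact setLIntegral_congr_fun hS fun s hs => by simp only [hφ s hs]

theorem dominatedAverages_id (s₀ : ℝ) {ε : ℝ} (hε : 0 < ε) :
    DominatedAverages (Metric.ball s₀ ε) (fun s => s) (fun _ => 1) := by
  refine ⟨(|s₀| + ε).toNNReal, fun H hH x t ht => ?_⟩
  simp only [one_mul]
  refine (lintegral_mono_set fun s hs => ?_).trans
    (lintegral_ball_comp_le H x ht (ρ := |s₀| + ε) (by positivity))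
  rw [Metric.mem_ball, Real.dist_eq] at hs ⊢
  calc |s - 0| = |s₀ + (s - s₀)| := by ring_nf
    _ ≤ |s₀| + |s - s₀| := abs_add_le _ _
    _ < _ := by gcongr

theorem dominatedAverages_id_radial {ε β : ℝ} (hε : 0 < ε) (hβ : 0 ≤ β) (hβ1 : β < 1) :
    DominatedAverages (Metric.ball 0 ε) (fun s => s)
      (fun s => ENNReal.ofReal (|s - 0| ^ (-β))) := by
  simp only [sub_zero]
  exact lintegral_radial_le hβ hβ1 hε

theorem lintegral_radial_ne_top (s₀ : ℝ) {ε β : ℝ} (hε : 0 < ε) (hβ : 0 ≤ β) (hβ1 : β < 1) :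
    ∫⁻ s in Metric.ball s₀ ε, ENNReal.ofReal (|s - s₀| ^ (-β)) ≠ ⊤ := by
  obtain ⟨C, hC⟩ := lintegral_radial_le hβ hβ1 hε
  have h := hC (fun _ => 1) measurable_const 0 1 one_pos
  have hM : hardyLittlewood (fun _ => 1) 0 ≤ 2 := by
    refine (hardyLittlewood_le_essSup _ _).trans (le_of_eq ?_)
    rw [essSup_const _ (NeZero.ne volume), mul_one]
  have e : ∫⁻ s in Metric.ball s₀ ε, ENNReal.ofReal (|s - s₀| ^ (-β)) =
      ∫⁻ s in Metric.ball 0 ε, ENNReal.ofReal (|s| ^ (-β)) := by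
    rw [← lintegral_indicator measurableSet_ball, ← lintegral_indicator measurableSet_ball]
    refine Eq.trans ?_ (lintegral_sub_right_eq_self _ s₀)
    refine lintegral_congr fun s => ?_
    simp [indicator, Real.dist_eq]
  rw [e]
  simp only [mul_one] at h
  exact ((h.trans (mul_le_mul_right hM _)).trans_lt
    (ENNReal.mul_lt_top ENNReal.coe_lt_top (by norm_num))).ne

namespace FiniteTypeOn

variable {m : ℕ} {h dh : ℝ → ℝ} {s₀ ε c C : ℝ}

/-- Rolle's theorem: the derivative vanishes at most at s₀, which is excluded from the interior of
A. It may be an endpoint, which `ne_value` uses. -/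
theorem injOn (H : FiniteTypeOn m h dh s₀ ε c C) {A : Set ℝ} (hA : A.OrdConnected)
    (hAε : ∀ s ∈ A, |s - s₀| < ε) (hA0 : ∀ s ∈ A, s ∉ interior A ∨ s ≠ s₀) : InjOn h A := by
  have key : ∀ x ∈ A, ∀ y ∈ A, x < y → h x ≠ h y := by
    intro x hx y hy hxy hh
    have hsub : Icc x y ⊆ A := hA.out hx hy
    obtain ⟨z, hz, hz0⟩ := exists_hasDerivAt_eq_zero (f' := dh) hxy
      (fun s hs => (H.hasDerivAt s (hAε s (hsub hs))).continuousAt.continuousWithinAt) hh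
      (fun s hs => H.hasDerivAt s (hAε s (hsub (Ioo_subset_Icc_self hs))))
    have hzA := hsub (Ioo_subset_Icc_self hz)
    have hint : z ∈ interior A :=
      interior_mono (Ioo_subset_Icc_self.trans hsub) (by simpa using hz)
    have hz0' : z ≠ s₀ := (hA0 z hzA).resolve_left (not_not.2 hint)
    have := H.lower z (hAε z hzA)
    rw [hz0, abs_zero] at this
    have hpos : 0 < c * |z - s₀| ^ (m - 1) :=
      mul_pos H.lower_pos (pow_pos (abs_pos.2 (sub_ne_zero.2 hz0')) _)
    linarith
  intro x hx y hy hh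
  rcases lt_trichotomy x y with hlt | rfl | hlt
  · exact absurd hh (key x hx y hy hlt)
  · rfl
  · exact absurd hh.symm (key y hy x hx hlt)

theorem ne_value (H : FiniteTypeOn m h dh s₀ ε c C) {s : ℝ} (hs : |s - s₀| < ε) (hs0 : s ≠ s₀) :
    h s ≠ h s₀ := by
  have hsub : ∀ u ∈ uIcc s₀ s, |u - s₀| < ε := fun u hu =>
    (abs_sub_left_of_mem_uIcc hu).trans_lt hs
  have hinj : InjOn h (uIcc s₀ s) := by
    refine H.injOn ordConnected_uIcc hsub fun u hu => ?_
    by_cases hu0 : u = s₀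
    · left
      rw [hu0, uIcc, interior_Icc]
      rintro ⟨h1, h2⟩
      simp at h1 h2
      linarith
    · exact Or.inr hu0
  exact fun hh => hs0 (hinj right_mem_uIcc left_mem_uIcc hh)

theorem lintegral_comp_le_of_injOn (H : FiniteTypeOn m h dh s₀ ε c C) {A : Set ℝ}
    (hA : MeasurableSet A) (hAε : ∀ s ∈ A, |s - s₀| < ε) (hinj : InjOn h A) (Φ : ℝ → ℝ≥0∞) :
    ∫⁻ s in A, ENNReal.ofReal (|s - s₀| ^ (m - 1)) * Φ (h s) ≤
      ENNReal.ofReal c⁻¹ * ∫⁻ u in Metric.ball 0 (|h s₀| + C * ε ^ m + 1), Φ u := by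
  have hc := H.lower_pos
  have himg : h '' A ⊆ Metric.ball 0 (|h s₀| + C * ε ^ m + 1) := by
    rintro _ ⟨s, hs, rfl⟩
    have h1 := H.upper s (hAε s hs)
    have h2 : C * |s - s₀| ^ m ≤ C * ε ^ m :=
      mul_le_mul_of_nonneg_left (pow_le_pow_left₀ (abs_nonneg _) (hAε s hs).le _) H.upper_pos.le
    have h3 := abs_add_le (h s₀) (h s - h s₀)
    rw [add_sub_cancel] at h3
    rw [Metric.mem_ball, Real.dist_eq, sub_zero]
    linarith
  calc _ ≤ ∫⁻ s in A, ENNReal.ofReal c⁻¹ * (ENNReal.ofReal |dh s| * Φ (h s)) := by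
        refine setLIntegral_mono' hA fun s hs => ?_
        rw [← mul_assoc, ← ENNReal.ofReal_mul (by positivity)]
        gcongr
        have := H.lower s (hAε s hs)
        rw [le_inv_mul_iff₀ hc]; exact this
    _ = ENNReal.ofReal c⁻¹ * ∫⁻ u in h '' A, Φ u := by
        rw [lintegral_const_mul' _ _ ENNReal.ofReal_ne_top,
          lintegral_image_eq_lintegral_abs_deriv_mul hA
          (fun s hs => (H.hasDerivAt s (hAε s hs)).hasDerivWithinAt) hinj]
    _ ≤ _ := by gcongr

/-- The substitution u = h(s) on each side of s₀, where h is injective; the weight is at most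
|h'|/c, and the two sides give the factor 2. -/
theorem lintegral_comp_le (H : FiniteTypeOn m h dh s₀ ε c C) (Φ : ℝ → ℝ≥0∞) :
    ∫⁻ s in Metric.ball s₀ ε, ENNReal.ofReal (|s - s₀| ^ (m - 1)) * Φ (h s) ≤
      ENNReal.ofReal (2 * c⁻¹) * ∫⁻ u in Metric.ball 0 (|h s₀| + C * ε ^ m + 1), Φ u := by
  have hsub : (Metric.ball s₀ ε : Set ℝ) ⊆ {s₀} ∪ (Ioo (s₀ - ε) s₀ ∪ Ioo s₀ (s₀ + ε)) := by
    intro s hs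
    rw [Real.ball_eq_Ioo] at hs
    rcases lt_trichotomy s s₀ with h1 | h1 | h1
    · exact Or.inr (Or.inl ⟨hs.1, h1⟩)
    · exact Or.inl h1
    · exact Or.inr (Or.inr ⟨h1, hs.2⟩)
  have h1 : ∀ s ∈ Ioo (s₀ - ε) s₀, |s - s₀| < ε := fun s hs => by
    rw [abs_lt]; constructor <;> linarith [hs.1, hs.2, H.radius_pos]
  have h2 : ∀ s ∈ Ioo s₀ (s₀ + ε), |s - s₀| < ε := fun s hs => by
    rw [abs_lt]; constructor <;> linarith [hs.1, hs.2, H.radius_pos]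
  have i1 := H.lintegral_comp_le_of_injOn measurableSet_Ioo h1
    (H.injOn ordConnected_Ioo h1 fun s hs => Or.inr hs.2.ne) Φ
  have i2 := H.lintegral_comp_le_of_injOn measurableSet_Ioo h2
    (H.injOn ordConnected_Ioo h2 fun s hs => Or.inr hs.1.ne') Φ
  calc _ ≤ _ := lintegral_mono_set hsub
    _ ≤ _ := lintegral_union_le _ _ _
    _ ≤ 0 + _ := add_le_add (by simp) (lintegral_union_le _ _ _)
    _ ≤ 0 + (_ + _) := add_le_add le_rfl (add_le_add i1 i2)
    _ = _ := by
      rw [ENNReal.ofReal_mul (by norm_num), zero_add, ← two_mul, ← mul_assoc]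
      norm_num

theorem dominatedAverages (H : FiniteTypeOn m h dh s₀ ε c C) :
    DominatedAverages (Metric.ball s₀ ε) h
      (fun s => ENNReal.ofReal (|s - s₀| ^ ((m - 1 : ℕ) : ℝ))) := by
  set K := |h s₀| + C * ε ^ m + 1
  have hK : 0 < K := by have := H.upper_pos; have := H.radius_pos; positivity
  refine ⟨(2 * c⁻¹).toNNReal * K.toNNReal, fun F hF x t ht => ?_⟩
  simp only [Real.rpow_natCast]
  refine (H.lintegral_comp_le (fun u => F (x - t * u))).trans ?_
  push_cast
  rw [mul_assoc]
  exact mul_le_mul_right (lintegral_ball_comp_le F x ht hK) _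

theorem dominatedAverages_of_value_zero (H : FiniteTypeOn m h dh s₀ ε c C) (hm : 1 ≤ m)
    (h0 : h s₀ = 0) :
    DominatedAverages (Metric.ball s₀ ε) h (fun _ => 1) := by
  have hC := H.upper_pos
  set K := |h s₀| + C * ε ^ m + 1
  have hK : 0 < K := by have := H.radius_pos; positivity
  -- From |h(s)| ≤ C|s - s₀|^m this power gives |h(s)|^{-β} ≥ C^{-β}|s - s₀|^{-(m-1)}, so the kernel
  -- |u|^{-β} absorbs the inverse Jacobian, and β < 1.
  set β : ℝ := (m - 1 : ℕ) / m
  have hm0 : (0 : ℝ) < m := by exact_mod_cast hm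
  have hβ : 0 ≤ β := by positivity
  have hβ1 : β < 1 := by
    rw [div_lt_one hm0]; exact_mod_cast Nat.sub_lt hm one_pos
  obtain ⟨D, hD⟩ := lintegral_radial_le hβ hβ1 hK
  refine ⟨(2 * c⁻¹).toNNReal * ((C ^ β).toNNReal * D), fun F hF x t ht => ?_⟩
  have hpt : ∀ᵐ s ∂(volume.restrict (Metric.ball s₀ ε)), 1 * F (x - t * h s) ≤
      ENNReal.ofReal (|s - s₀| ^ (m - 1)) * (ENNReal.ofReal (C ^ β) *
        (ENNReal.ofReal (|h s| ^ (-β)) * F (x - t * h s))) := by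
    filter_upwards [ae_restrict_mem measurableSet_ball,
      ae_restrict_of_ae (Measure.ae_ne volume s₀)] with s hs hs0
    rw [Metric.mem_ball, Real.dist_eq] at hs
    have hne := H.ne_value hs hs0
    rw [h0] at hne
    have hu := H.upper s hs
    rw [h0, sub_zero] at hu
    have hpos : 0 < |s - s₀| := abs_pos.2 (sub_ne_zero.2 hs0)
    have h1 := Real.rpow_le_rpow_of_nonpos (abs_pos.2 hne) hu (neg_nonpos.2 hβ)
    have h2 : (|s - s₀| ^ m) ^ β = |s - s₀| ^ (m - 1) := by
      rw [← Real.rpow_natCast, ← Real.rpow_mul hpos.le, mul_div_cancel₀ _ hm0.ne',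
        Real.rpow_natCast]
    rw [Real.rpow_neg (by positivity), Real.mul_rpow hC.le (by positivity), h2] at h1
    rw [← mul_assoc, ← mul_assoc, ← ENNReal.ofReal_mul (by positivity),
      ← ENNReal.ofReal_mul (by positivity)]
    gcongr
    rw [ENNReal.one_le_ofReal]
    have hCβ : 0 < C ^ β := Real.rpow_pos_of_pos hC _
    calc (1 : ℝ) = |s - s₀| ^ (m - 1) * C ^ β * (C ^ β * |s - s₀| ^ (m - 1))⁻¹ := by
          field_simp
      _ ≤ _ := by gcongr
  refine (lintegral_mono_ae hpt).trans ?_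
  refine (H.lintegral_comp_le (fun u => ENNReal.ofReal (C ^ β) *
    (ENNReal.ofReal (|u| ^ (-β)) * F (x - t * u)))).trans ?_
  push_cast
  rw [lintegral_const_mul' _ _ ENNReal.ofReal_ne_top, mul_assoc, mul_assoc]
  exact mul_le_mul_right (mul_le_mul_right (hD F hF x t ht) _) _

end FiniteTypeOn

/-! ### Sufficiency: choice of weights and exponents -/

theorem one_le_weights {a b c β₁ κ β₃ u : ℝ} (ha : 0 < a) (hb : 0 < b) (hc : 0 < c) (hu : u ≠ 0)
    (h : κ * b = β₁ * a + β₃ * c) :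
    1 ≤ ENNReal.ofReal (|u| ^ (-β₁)) ^ a * ENNReal.ofReal (|u| ^ κ) ^ b *
      ENNReal.ofReal (|u| ^ (-β₃)) ^ c := by
  have hpos : 0 < |u| := abs_pos.2 hu
  rw [ENNReal.ofReal_rpow_of_nonneg (by positivity) ha.le,
    ENNReal.ofReal_rpow_of_nonneg (by positivity) hb.le,
    ENNReal.ofReal_rpow_of_nonneg (by positivity) hc.le, ← ENNReal.ofReal_mul (by positivity),
    ← ENNReal.ofReal_mul (by positivity), ← Real.rpow_mul hpos.le, ← Real.rpow_mul hpos.le,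
    ← Real.rpow_mul hpos.le, ← Real.rpow_add hpos, ← Real.rpow_add hpos,
    show -β₁ * a + κ * b + -β₃ * c = 0 by linarith, Real.rpow_zero, ENNReal.ofReal_one]

section Sufficiency

variable {m : ℕ} {γ : ℝ → ℝ × ℝ} {dh ψ : ℝ → ℝ} {s₀ ε c C : ℝ} {p q r : ℝ≥0∞}

/-- The estimate for three admissible power weights. -/
theorem FiniteTypeOn.estimate_of_power_weights
    (H : FiniteTypeOn m (fun s => (γ s).2) dh s₀ ε c C)
    (hγ : ∀ s, |s - s₀| < ε → (γ s).1 = s) (hψc : Continuous ψ) (hψs : HasCompactSupport ψ)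
    (hψS : ∀ s, ε ≤ |s - s₀| → ψ s = 0) (hp0 : 0 < p) (hq0 : 0 < q) (hr : r⁻¹ = p⁻¹ + q⁻¹)
    {a b d β₁ κ β₃ : ℝ} (ha : 0 < a) (hb : 0 < b) (hd : 0 < d) (habd : a + b + d = 1)
    (hpa : p⁻¹ < ENNReal.ofReal a) (hqb : q⁻¹ < ENNReal.ofReal b)
    (hβκ : κ * b = β₁ * a + β₃ * d) (hβ₃ : 0 ≤ β₃) (hβ₃1 : β₃ < 1)
    (h₁ : DominatedAverages (Metric.ball s₀ ε) (fun s => s)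
      (fun s => ENNReal.ofReal (|s - s₀| ^ (-β₁))))
    (h₂ : DominatedAverages (Metric.ball s₀ ε) (fun s => (γ s).2)
      (fun s => ENNReal.ofReal (|s - s₀| ^ κ))) :
    MaximalEstimate γ ψ p q r ∧ AveragesConverge γ ψ p q := by
  have hball : ∀ s, s ∈ Metric.ball s₀ ε ↔ |s - s₀| < ε := fun s => by
    rw [Metric.mem_ball, Real.dist_eq]
  refine maximalEstimate_and_averagesConverge_of_weights (S := Metric.ball s₀ ε)
    (V₁ := fun s => ENNReal.ofReal (|s - s₀| ^ (-β₁)))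
    (V₂ := fun s => ENNReal.ofReal (|s - s₀| ^ κ))
    (V₃ := fun s => ENNReal.ofReal (|s - s₀| ^ (-β₃)))
    measurableSet_ball hψc hψs (fun s hs => hψS s ?_) ?_ ?_ ha hb hd habd
    (by fun_prop) (by fun_prop) (by fun_prop) ?_
    (h₁.congr measurableSet_ball fun s hs => hγ s ((hball s).1 hs)) h₂
    (lintegral_radial_ne_top s₀ H.radius_pos hβ₃ hβ₃1) hp0 hq0 hr hpa hqb
  · rw [hball] at hs; exact not_lt.1 hs
  · refine AEMeasurable.congr (f := fun s => s) (by fun_prop) ?_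
    filter_upwards [ae_restrict_mem measurableSet_ball] with s hs
    exact (hγ s ((hball s).1 hs)).symm
  · refine ContinuousOn.aemeasurable (fun s hs => ?_) measurableSet_ball
    exact (H.hasDerivAt s ((hball s).1 hs)).continuousAt.continuousWithinAt
  · filter_upwards [ae_restrict_of_ae (Measure.ae_ne volume s₀)] with s hs
    exact one_le_weights ha hb hd (sub_ne_zero.2 hs) hβκ

theorem inv_lt_ofReal {p : ℝ≥0∞} (hp : 0 < p) {a : ℝ} (h : (p⁻¹).toReal < a) :
    p⁻¹ < ENNReal.ofReal a :=
  (ENNReal.lt_ofReal_iff_toReal_lt (ENNReal.inv_ne_top.2 hp.ne')).2 h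

theorem FiniteTypeOn.estimate_of_origin
    (H : FiniteTypeOn m (fun s => (γ s).2) dh s₀ ε c C) (hm : 2 ≤ m)
    (hγ : ∀ s, |s - s₀| < ε → (γ s).1 = s) (hψc : Continuous ψ) (hψs : HasCompactSupport ψ)
    (hψS : ∀ s, ε ≤ |s - s₀| → ψ s = 0) (hp0 : 0 < p) (hq0 : 0 < q) (hr : r⁻¹ = p⁻¹ + q⁻¹)
    (h0 : (γ s₀).2 = 0) (hpq : (p⁻¹).toReal + (q⁻¹).toReal < 1) :
    MaximalEstimate γ ψ p q r ∧ AveragesConverge γ ψ p q := by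
  have hP : 0 ≤ (p⁻¹).toReal := ENNReal.toReal_nonneg
  have hQ : 0 ≤ (q⁻¹).toReal := ENNReal.toReal_nonneg
  set P := (p⁻¹).toReal
  set Q := (q⁻¹).toReal
  set δ := (1 - P - Q) / 3 with hδ
  have hδ0 : 0 < δ := by rw [hδ]; linarith
  have e0 : (fun s => ENNReal.ofReal (|s - s₀| ^ (0 : ℝ))) = fun _ => 1 := by simp
  refine H.estimate_of_power_weights hγ hψc hψs hψS hp0 hq0 hr
    (a := P + δ) (b := Q + δ) (d := δ) (β₁ := 0) (κ := 0) (β₃ := 0) (by linarith) (by linarith)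
    hδ0 (by rw [hδ]; ring) (inv_lt_ofReal hp0 (by linarith)) (inv_lt_ofReal hq0 (by linarith))
    (by ring) le_rfl one_pos ?_ ?_
  · rw [neg_zero, e0]; exact dominatedAverages_id s₀ H.radius_pos
  · rw [e0]; exact H.dominatedAverages_of_value_zero (by omega) h0

theorem FiniteTypeOn.estimate_of_parameter_zero
    (H : FiniteTypeOn m (fun s => (γ s).2) dh 0 ε c C) (hm : 2 ≤ m)
    (hγ : ∀ s, |s - 0| < ε → (γ s).1 = s) (hψc : Continuous ψ) (hψs : HasCompactSupport ψ)
    (hψS : ∀ s, ε ≤ |s - 0| → ψ s = 0) (hp0 : 0 < p) (hq0 : 0 < q) (hr : r⁻¹ = p⁻¹ + q⁻¹)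
    (hpq : (p⁻¹).toReal + (q⁻¹).toReal < 1) (hq : m * (q⁻¹).toReal < 1) :
    MaximalEstimate γ ψ p q r ∧ AveragesConverge γ ψ p q := by
  have hP : 0 ≤ (p⁻¹).toReal := ENNReal.toReal_nonneg
  have hQ : 0 ≤ (q⁻¹).toReal := ENNReal.toReal_nonneg
  set P := (p⁻¹).toReal
  set Q := (q⁻¹).toReal
  have hm2 : (2 : ℝ) ≤ m := by exact_mod_cast hm
  have hm1 : ((m - 1 : ℕ) : ℝ) = m - 1 := by rw [Nat.cast_sub (by omega)]; simp
  -- The bound 1 - P leaves room for a > P with a + b < 1; the bound 1/m is what makes β < 1 below.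
  obtain ⟨b, hb1, hb2⟩ : ∃ b, Q < b ∧ b < min (1 - P) (1 / m) :=
    exists_between (lt_min (by linarith) (by rw [lt_div_iff₀ (by linarith)]; linarith))
  have hb3 := hb2.trans_le (min_le_left _ _)
  have hb4 := hb2.trans_le (min_le_right _ _)
  rw [lt_div_iff₀ (by linarith)] at hb4
  have hb0 : 0 < b := by linarith
  have hb5 : b < 1 := by nlinarith
  obtain ⟨a, ha1, ha2⟩ : ∃ a, P < a ∧ a < 1 - b := exists_between (by linarith)
  -- The same β serves V₁ and V₃, so the balance is (m-1)b = β(a + d) = β(1 - b), independent of a.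
  set β := (m - 1) * b / (1 - b) with hβ
  have hβ0 : 0 ≤ β := div_nonneg (mul_nonneg (by linarith) hb0.le) (by linarith)
  have hβ1 : β < 1 := by rw [div_lt_one (by linarith)]; linarith
  refine H.estimate_of_power_weights hγ hψc hψs hψS hp0 hq0 hr
    (a := a) (b := b) (d := 1 - a - b) (β₁ := β) (κ := (m - 1 : ℕ)) (β₃ := β) (by linarith) hb0
    (by linarith) (by ring) (inv_lt_ofReal hp0 ha1) (inv_lt_ofReal hq0 hb1)
    ?_ hβ0 hβ1 ?_ ?_
  · rw [hm1, ← mul_add, show a + (1 - a - b) = 1 - b by ring, hβ,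
      div_mul_cancel₀ _ (by linarith : (1 - b) ≠ 0)]
  · exact dominatedAverages_id_radial H.radius_pos hβ0 hβ1
  · exact H.dominatedAverages

theorem FiniteTypeOn.estimate_of_generic
    (H : FiniteTypeOn m (fun s => (γ s).2) dh s₀ ε c C) (hm : 2 ≤ m)
    (hγ : ∀ s, |s - s₀| < ε → (γ s).1 = s) (hψc : Continuous ψ) (hψs : HasCompactSupport ψ)
    (hψS : ∀ s, ε ≤ |s - s₀| → ψ s = 0) (hp0 : 0 < p) (hq0 : 0 < q) (hr : r⁻¹ = p⁻¹ + q⁻¹)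
    (hpq : m * (q⁻¹).toReal + (p⁻¹).toReal < 1) :
    MaximalEstimate γ ψ p q r ∧ AveragesConverge γ ψ p q := by
  have hP : 0 ≤ (p⁻¹).toReal := ENNReal.toReal_nonneg
  have hQ : 0 ≤ (q⁻¹).toReal := ENNReal.toReal_nonneg
  set P := (p⁻¹).toReal
  set Q := (q⁻¹).toReal
  have hm2 : (2 : ℝ) ≤ m := by exact_mod_cast hm
  have hm1 : ((m - 1 : ℕ) : ℝ) = m - 1 := by rw [Nat.cast_sub (by omega)]; simp
  -- Here V₃ alone compensates, and β < 1 reads P + mQ + (m+1)δ < 1; the denominator m + 2 makes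
  -- this strict.
  set δ := (1 - P - m * Q) / (m + 2) with hδ
  have hδ0 : 0 < δ := div_pos (by linarith) (by linarith)
  have hδe : δ * (m + 2) = 1 - P - m * Q := div_mul_cancel₀ _ (by linarith)
  have hd : 0 < 1 - (P + δ) - (Q + δ) := by nlinarith
  set β := (m - 1) * (Q + δ) / (1 - (P + δ) - (Q + δ)) with hβ
  have hβ0 : 0 ≤ β := div_nonneg (mul_nonneg (by linarith) (by linarith)) hd.le
  have hβ1 : β < 1 := by rw [div_lt_one hd]; nlinarith
  refine H.estimate_of_power_weights hγ hψc hψs hψS hp0 hq0 hr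
    (a := P + δ) (b := Q + δ) (d := 1 - (P + δ) - (Q + δ)) (β₁ := 0) (κ := (m - 1 : ℕ)) (β₃ := β)
    (by linarith) (by linarith) hd (by ring) (inv_lt_ofReal hp0 (by linarith))
    (inv_lt_ofReal hq0 (by linarith)) ?_ hβ0 hβ1 ?_ ?_
  · rw [hm1, hβ, div_mul_cancel₀ _ hd.ne']; ring
  · simpa using dominatedAverages_id s₀ H.radius_pos
  · exact H.dominatedAverages

end Sufficiency

/-! ### Necessity: superposition of dyadic scales -/

/-- Test functions whose norms grow slower than the number of scales `k < N` on which the maximal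
function is large violate the maximal estimate. -/
theorem MaximalEstimate.false_of_tests {γ : ℝ → ℝ × ℝ} {ψ : ℝ → ℝ} {p q r : ℝ≥0∞}
    (hest : MaximalEstimate γ ψ p q r) (hr0 : r ≠ 0) (hrt : r ≠ ⊤) {θ D κ : ℝ}
    (hθ : θ < r.toReal⁻¹) (hκ : 0 < κ) {b : ℕ → ℝ} {X : ℕ → Set ℝ}
    (hX : ∀ k, MeasurableSet (X k)) (hXd : Pairwise fun i j => Disjoint (X i) (X j))
    (hb : ∀ k, ENNReal.ofReal κ ≤ ENNReal.ofReal (b k) ^ r.toReal * volume (X k))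
    (htest : ∀ N : ℕ, 0 < N → ∃ f g : ℝ → ℂ, MemLp f p volume ∧ MemLp g q volume ∧
      eLpNorm f p volume * eLpNorm g q volume ≤ ENNReal.ofReal (D * (N : ℝ) ^ θ) ∧
      ∀ k < N, ∀ x ∈ X k, ENNReal.ofReal (b k) ≤ bilinearMaximal γ ψ f g x) : False := by
  obtain ⟨C, hC⟩ := hest
  have hR : 0 < r.toReal := ENNReal.toReal_pos hr0 hrt
  set R := r.toReal
  -- Each of the N disjoint sets contributes at least κ to ∫ 𝓜^R, so (Nκ)^{1/R} ≤ C D N^θ.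
  have key : ∀ N : ℕ, 0 < N → (N : ℝ) ^ (R⁻¹ - θ) ≤ C * D * (κ ^ R⁻¹)⁻¹ := by
    intro N hN
    obtain ⟨f, g, hf, hg, hfg, hM⟩ := htest N hN
    have hNr : (0 : ℝ) < N := by exact_mod_cast hN
    have h1 : ENNReal.ofReal (N * κ) ≤ ∫⁻ x, bilinearMaximal γ ψ f g x ^ R := by
      calc ENNReal.ofReal (N * κ) = ∑ k ∈ Finset.range N, ENNReal.ofReal κ := by
            rw [Finset.sum_const, Finset.card_range, nsmul_eq_mul, ENNReal.ofReal_mul hNr.le,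
              ENNReal.ofReal_natCast]
        _ ≤ ∑ k ∈ Finset.range N, ∫⁻ x in X k, bilinearMaximal γ ψ f g x ^ R := by
            refine Finset.sum_le_sum fun k hk => (hb k).trans ?_
            rw [← setLIntegral_const]
            refine setLIntegral_mono' (hX k) fun x hx => ?_
            gcongr
            exact hM k (Finset.mem_range.1 hk) x hx
        _ = ∫⁻ x in ⋃ k ∈ Finset.range N, X k, bilinearMaximal γ ψ f g x ^ R :=
            (lintegral_biUnion_finset (fun i _ j _ hij => hXd hij) (fun k _ => hX k) _).symm
        _ ≤ _ := setLIntegral_le_lintegral _ _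
    have h2 := hC f g hf hg
    rw [eLpNorm_eq_lintegral_rpow_enorm_toReal hr0 hrt] at h2
    simp only [enorm_eq_self, one_div] at h2
    have h3 : ENNReal.ofReal ((N * κ) ^ R⁻¹) ≤ ENNReal.ofReal (C * (D * (N : ℝ) ^ θ)) := by
      rw [← ENNReal.ofReal_rpow_of_nonneg (by positivity) (by positivity),
        ENNReal.ofReal_mul C.coe_nonneg, ENNReal.ofReal_coe_nnreal]
      calc _ ≤ (∫⁻ x, bilinearMaximal γ ψ f g x ^ R) ^ R⁻¹ := by gcongr
        _ ≤ _ := h2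
        _ ≤ _ := by rw [mul_assoc]; gcongr
    have hpos : 0 < (N * κ) ^ R⁻¹ := by positivity
    have h4 : (N * κ) ^ R⁻¹ ≤ C * (D * (N : ℝ) ^ θ) := by
      by_contra hcon
      exact absurd h3 (not_le.2 ((ENNReal.ofReal_lt_ofReal_iff hpos).2 (not_le.1 hcon)))
    rw [Real.mul_rpow hNr.le hκ.le] at h4
    have hκR : 0 < κ ^ R⁻¹ := by positivity
    have hNθ : 0 < (N : ℝ) ^ θ := by positivity
    rw [Real.rpow_sub hNr, div_le_iff₀ hNθ, ← div_eq_mul_inv, div_mul_eq_mul_div, le_div_iff₀ hκR]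
    linarith
  have htend := (tendsto_rpow_atTop (sub_pos.2 hθ)).comp (tendsto_natCast_atTop_atTop (R := ℝ))
  obtain ⟨N, hN1, hN2⟩ := ((htend.eventually_gt_atTop (C * D * (κ ^ R⁻¹)⁻¹)).and
    (eventually_gt_atTop 0)).exists
  exact absurd (key N hN2) (not_le.2 hN1)

/-- The regularity that makes the integrals of bounded functions against `ψ` along `γ`
meaningful. -/
structure CurveCutoff (γ : ℝ → ℝ × ℝ) (ψ : ℝ → ℝ) (S : Set ℝ) : Prop where
  measurableSet : MeasurableSet S
  continuous : Continuous ψ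
  hasCompactSupport : HasCompactSupport ψ
  nonneg : ∀ s, 0 ≤ ψ s
  eq_zero : ∀ s ∉ S, ψ s = 0
  aemeasurable_fst : AEMeasurable (fun s => (γ s).1) (volume.restrict S)
  aemeasurable_snd : AEMeasurable (fun s => (γ s).2) (volume.restrict S)

/-- All factors are nonnegative, so the integral is at least its part over the window. Boundedness
of `F` and `G` ensures integrability; without it the Bochner integral would be 0. -/
theorem CurveCutoff.le_bilinearMaximal {γ : ℝ → ℝ × ℝ} {ψ : ℝ → ℝ} {S : Set ℝ}
    (H : CurveCutoff γ ψ S) {F G : ℝ → ℝ} (hF : Measurable F) (hG : Measurable G)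
    (hF0 : ∀ y, 0 ≤ F y) (hG0 : ∀ y, 0 ≤ G y) {BF BG : ℝ} (hFB : ∀ y, F y ≤ BF)
    (hGB : ∀ y, G y ≤ BG) {x t₁ t₂ σ w α c : ℝ} (ht₁ : 0 < t₁) (ht₂ : 0 < t₂)
    (hα : 0 ≤ α) (hc : 0 ≤ c)
    (h : ∀ s, |s - σ| < w → α ≤ F (x - t₁ * (γ s).1) ∧ 1 ≤ G (x - t₂ * (γ s).2) ∧ c ≤ ψ s) :
    ENNReal.ofReal (2 * w * α * c) ≤
      bilinearMaximal γ ψ (fun y => (F y : ℂ)) (fun y => (G y : ℂ)) x := by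
  have hle : ‖∫ s, bilinearIntegrand γ ψ (fun y => (F y : ℂ)) (fun y => (G y : ℂ)) t₁ t₂ x s‖ₑ ≤
      bilinearMaximal γ ψ (fun y => (F y : ℂ)) (fun y => (G y : ℂ)) x :=
    le_iSup_of_le t₁ (le_iSup_of_le ht₁ (le_iSup_of_le t₂ (le_iSup_of_le ht₂ le_rfl)))
  refine le_trans ?_ hle
  set φ : ℝ → ℝ := fun s => F (x - t₁ * (γ s).1) * G (x - t₂ * (γ s).2) * ψ s with hφ
  have hφ0 : ∀ s, 0 ≤ φ s := fun s => mul_nonneg (mul_nonneg (hF0 _) (hG0 _)) (H.nonneg s)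
  have hφe : ∀ s, bilinearIntegrand γ ψ (fun y => (F y : ℂ)) (fun y => (G y : ℂ)) t₁ t₂ x s =
      (φ s : ℂ) := fun s => by simp [bilinearIntegrand, hφ]
  have hφm : AEStronglyMeasurable φ volume := by
    have hind : φ = S.indicator φ := by
      ext s
      by_cases hs : s ∈ S
      · rw [indicator_of_mem hs]
      · rw [indicator_of_notMem hs]; simp [hφ, H.eq_zero s hs]
    rw [hind, aestronglyMeasurable_indicator_iff H.measurableSet]
    have h1 := H.aemeasurable_fst
    have h2 := H.aemeasurable_snd
    exact (((hF.comp_aemeasurable (by fun_prop)).mul (hG.comp_aemeasurable (by fun_prop))).mul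
      H.continuous.measurable.aemeasurable).aestronglyMeasurable
  have hφi : Integrable φ volume := by
    refine ((H.continuous.integrable_of_hasCompactSupport H.hasCompactSupport).const_mul
      (BF * BG)).mono' hφm (ae_of_all _ fun s => ?_)
    rw [Real.norm_of_nonneg (hφ0 s)]
    exact mul_le_mul_of_nonneg_right (mul_le_mul (hFB _) (hGB _) (hG0 _)
      ((hF0 0).trans (hFB 0))) (H.nonneg s)
  simp_rw [hφe]
  rw [integral_complex_ofReal, ← ofReal_norm, Complex.norm_real, Real.norm_eq_abs,
    abs_of_nonneg (integral_nonneg hφ0),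
    ofReal_integral_eq_lintegral_ofReal hφi (ae_of_all _ hφ0)]
  calc _ = ∫⁻ s in Metric.ball σ w, ENNReal.ofReal (α * c) := by
        rw [setLIntegral_const, Real.volume_ball, ← ENNReal.ofReal_mul (by positivity)]
        congr 1; ring
    _ ≤ ∫⁻ s in Metric.ball σ w, ENNReal.ofReal (φ s) := by
        refine setLIntegral_mono' measurableSet_ball fun s hs => ENNReal.ofReal_le_ofReal ?_
        rw [Metric.mem_ball, Real.dist_eq] at hs
        obtain ⟨h1, h2, h3⟩ := h s hs
        have h4 : α * 1 ≤ F (x - t₁ * (γ s).1) * G (x - t₂ * (γ s).2) :=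
          mul_le_mul h1 h2 zero_le_one (hF0 _)
        rw [mul_one] at h4
        exact mul_le_mul h4 h3 hc (mul_nonneg (hF0 _) (hG0 _))
    _ ≤ _ := setLIntegral_le_lintegral _ _

theorem memLp_ofReal_indicator_one (q : ℝ≥0∞) :
    MemLp (fun y => (((Icc (-1 : ℝ) 1).indicator (fun _ => (1 : ℝ)) y : ℝ) : ℂ)) q volume := by
  refine MemLp.ofReal (memLp_indicator_const q measurableSet_Icc 1 (Or.inr ?_))
  simp

/-- The superposition of the `L^p`-normalised indicators of disjoint sets. -/
theorem eLpNorm_sum_indicator_le {p : ℝ≥0∞} (hp0 : 0 < p) {E : ℕ → Set ℝ} {ℓ : ℕ → ℝ}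
    (hE : ∀ k, MeasurableSet (E k)) (hEd : Pairwise fun i j => Disjoint (E i) (E j))
    (hℓ : ∀ k, 0 < ℓ k) (hEℓ : ∀ k, volume (E k) = ENNReal.ofReal (ℓ k)) (N : ℕ) :
    eLpNorm (fun y => ((∑ k ∈ Finset.range N,
      (E k).indicator (fun _ => ℓ k ^ (-(p⁻¹).toReal)) y : ℝ) : ℂ)) p volume ≤
      ENNReal.ofReal ((N : ℝ) ^ (p⁻¹).toReal) := by
  set α : ℕ → ℝ := fun k => ℓ k ^ (-(p⁻¹).toReal) with hα
  have hα0 : ∀ k, 0 < α k := fun k => Real.rpow_pos_of_pos (hℓ k) _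
  have hval : ∀ y, (∃ k ∈ Finset.range N, y ∈ E k ∧
      (∑ k ∈ Finset.range N, (E k).indicator (fun _ => α k) y) = α k) ∨
      (∑ k ∈ Finset.range N, (E k).indicator (fun _ => α k) y) = 0 := by
    intro y
    by_cases hy : ∃ k ∈ Finset.range N, y ∈ E k
    · obtain ⟨k, hk, hyk⟩ := hy
      refine Or.inl ⟨k, hk, hyk, ?_⟩
      rw [Finset.sum_eq_single k, indicator_of_mem hyk]
      · intro j _ hjk
        exact indicator_of_notMem (fun hyj => (disjoint_left.1 (hEd hjk)) hyj hyk) _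
      · exact fun h => absurd hk h
    · push Not at hy
      exact Or.inr (Finset.sum_eq_zero fun k hk => indicator_of_notMem (hy k hk) _)
  have hnorm : ∀ z : ℝ, ‖(z : ℂ)‖ₑ = ENNReal.ofReal |z| := fun z => by
    rw [← ofReal_norm, Complex.norm_real, Real.norm_eq_abs]
  rcases eq_or_ne p ⊤ with rfl | hpt
  · simp only [ENNReal.inv_top, ENNReal.toReal_zero, Real.rpow_zero, ENNReal.ofReal_one,
      eLpNorm_exponent_top]
    refine eLpNormEssSup_le_of_ae_enorm_bound (ae_of_all _ fun y => ?_)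
    have hα1 : ∀ k, α k = 1 := fun k => by simp [hα]
    have := hval y
    simp only [hα, ENNReal.inv_top, ENNReal.toReal_zero, neg_zero, Real.rpow_zero] at this
    simp only [neg_zero, Real.rpow_zero]
    rcases this with ⟨k, _, _, h⟩ | h <;> rw [h] <;> simp
  · have hpr : 0 < p.toReal := ENNReal.toReal_pos hp0.ne' hpt
    rw [eLpNorm_eq_lintegral_rpow_enorm_toReal hp0.ne' hpt, ENNReal.toReal_inv, one_div,
      ← ENNReal.ofReal_rpow_of_nonneg (Nat.cast_nonneg N) (by positivity)]
    refine ENNReal.rpow_le_rpow ?_ (by positivity)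
    calc _ ≤ ∫⁻ y, ∑ k ∈ Finset.range N,
          (E k).indicator (fun _ => ENNReal.ofReal (α k) ^ p.toReal) y := by
          refine lintegral_mono fun y => ?_
          rw [hnorm]
          rcases hval y with ⟨k, hk, hyk, h⟩ | h
          · refine le_trans (le_of_eq ?_) (Finset.single_le_sum
              (f := fun k => (E k).indicator (fun _ => ENNReal.ofReal (α k) ^ p.toReal) y)
              (fun _ _ => zero_le) hk)
            rw [show (∑ k ∈ Finset.range N, (E k).indicator
              (fun _ => ℓ k ^ (-p.toReal⁻¹)) y) = α k by rw [← ENNReal.toReal_inv]; exact h,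
              indicator_of_mem hyk, abs_of_pos (hα0 k)]
          · rw [show (∑ k ∈ Finset.range N, (E k).indicator
              (fun _ => ℓ k ^ (-p.toReal⁻¹)) y) = 0 by rw [← ENNReal.toReal_inv]; exact h]
            simp [hpr]
      _ = ∑ k ∈ Finset.range N, ENNReal.ofReal (α k) ^ p.toReal * ENNReal.ofReal (ℓ k) := by
          rw [lintegral_finsetSum _ fun k _ => measurable_const.indicator (hE k)]
          refine Finset.sum_congr rfl fun k _ => ?_
          rw [lintegral_indicator_const (hE k), hEℓ]
      _ = ∑ k ∈ Finset.range N, 1 := by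
          refine Finset.sum_congr rfl fun k _ => ?_
          rw [ENNReal.ofReal_rpow_of_nonneg (hα0 k).le hpr.le,
            ← ENNReal.ofReal_mul (Real.rpow_nonneg (hα0 k).le _)]
          simp only [hα]
          rw [← Real.rpow_mul (hℓ k).le, ENNReal.toReal_inv, neg_mul, inv_mul_cancel₀ hpr.ne',
            Real.rpow_neg_one, inv_mul_cancel₀ (hℓ k).ne', ENNReal.ofReal_one]
      _ = ENNReal.ofReal N := by simp
      _ ≤ _ := le_rfl

theorem toReal_inv_holder {p q r : ℝ≥0∞} (hp0 : 0 < p) (hq0 : 0 < q) (hr : r⁻¹ = p⁻¹ + q⁻¹) :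
    r.toReal⁻¹ = (p⁻¹).toReal + (q⁻¹).toReal := by
  rw [← ENNReal.toReal_inv, hr, ENNReal.toReal_add (ENNReal.inv_ne_top.2 hp0.ne')
    (ENNReal.inv_ne_top.2 hq0.ne')]

theorem holder_exponent_ne {p q r : ℝ≥0∞} (hp0 : 0 < p) (hq0 : 0 < q) (hr : r⁻¹ = p⁻¹ + q⁻¹)
    (hpos : 0 < (p⁻¹).toReal + (q⁻¹).toReal) : r ≠ 0 ∧ r ≠ ⊤ := by
  rw [← toReal_inv_holder hp0 hq0 hr] at hpos
  have := ENNReal.toReal_pos_iff.1 (inv_pos.1 hpos)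
  exact ⟨this.1.ne', this.2.ne⟩

/-- The dyadic test: the set `X k` has length `≈ 2 ^ k`, for `x ∈ X k` the first variable stays in
`E k` and the second one in `[-1, 1]` for parameters in a window of length `≈ 2 ^ (-ν k)`. -/
theorem MaximalEstimate.false_of_dyadic {γ : ℝ → ℝ × ℝ} {ψ : ℝ → ℝ} {S : Set ℝ}
    {p q r : ℝ≥0∞} (hest : MaximalEstimate γ ψ p q r) (H : CurveCutoff γ ψ S)
    (hp0 : 0 < p) (hq0 : 0 < q) (hr : r⁻¹ = p⁻¹ + q⁻¹) (hqt : q ≠ ⊤)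
    {E X : ℕ → Set ℝ} {ℓ ξ w c σ ν lam : ℝ} (hℓ : 0 < ℓ) (hξ : 0 < ξ) (hw : 0 < w) (hc : 0 < c)
    (hE : ∀ k, MeasurableSet (E k)) (hEd : Pairwise fun i j => Disjoint (E i) (E j))
    (hEℓ : ∀ k, volume (E k) = ENNReal.ofReal (ℓ * (2 : ℝ) ^ (lam * k)))
    (hX : ∀ k, MeasurableSet (X k)) (hXd : Pairwise fun i j => Disjoint (X i) (X j))
    (hXξ : ∀ k, volume (X k) = ENNReal.ofReal (ξ * (2 : ℝ) ^ k))
    (hexp : ν + (p⁻¹).toReal * lam ≤ (p⁻¹).toReal + (q⁻¹).toReal)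
    (h : ∀ k : ℕ, ∀ x ∈ X k, ∃ t₁ t₂ : ℝ, 0 < t₁ ∧ 0 < t₂ ∧
      ∀ s, |s - σ| < w * (2 : ℝ) ^ (-(ν * k)) →
        x - t₁ * (γ s).1 ∈ E k ∧ |x - t₂ * (γ s).2| ≤ 1 ∧ c ≤ ψ s) : False := by
  have hQ : 0 < (q⁻¹).toReal :=
    ENNReal.toReal_pos (ENNReal.inv_ne_zero.2 hqt) (ENNReal.inv_ne_top.2 hq0.ne')
  have hP : 0 ≤ (p⁻¹).toReal := ENNReal.toReal_nonneg
  obtain ⟨hr0, hrt⟩ := holder_exponent_ne hp0 hq0 hr (by linarith)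
  have hPQ := toReal_inv_holder hp0 hq0 hr
  have hR : 0 < r.toReal := ENNReal.toReal_pos hr0 hrt
  set P := (p⁻¹).toReal with hPdef
  set Q := (q⁻¹).toReal
  set R := r.toReal
  have h2 : (0 : ℝ) < 2 := by norm_num
  have hℓk : ∀ k : ℕ, 0 < ℓ * (2 : ℝ) ^ (lam * k) := fun k => by positivity
  set α : ℕ → ℝ := fun k => (ℓ * (2 : ℝ) ^ (lam * k)) ^ (-P) with hα
  have hα0 : ∀ k, 0 < α k := fun k => Real.rpow_pos_of_pos (hℓk k) _
  set b : ℕ → ℝ := fun k => 2 * (w * (2 : ℝ) ^ (-(ν * k))) * α k * c with hb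
  have hbe : ∀ k : ℕ, b k = (2 * w * c * ℓ ^ (-P)) * (2 : ℝ) ^ (-(ν + P * lam) * k) := by
    intro k
    simp only [hb, hα]
    rw [Real.mul_rpow hℓ.le (by positivity), ← Real.rpow_mul h2.le,
      show -(ν + P * lam) * k = -(ν * k) + lam * k * (-P) by ring, Real.rpow_add h2]
    ring
  have hD := (memLp_ofReal_indicator_one q).2.ne
  set g : ℝ → ℂ := fun y => (((Icc (-1 : ℝ) 1).indicator (fun _ => (1 : ℝ)) y : ℝ) : ℂ)
  -- Since q is finite, P < P + Q = 1/r.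
  refine hest.false_of_tests hr0 hrt (θ := P) (D := (eLpNorm g q volume).toReal)
    (κ := (2 * w * c * ℓ ^ (-P)) ^ R * ξ) (b := b) (X := X)
    (by linarith) (by positivity) hX hXd ?_ ?_
  · intro k
    have hA : 0 < 2 * w * c * ℓ ^ (-P) := by positivity
    rw [hXξ, hbe, ENNReal.ofReal_rpow_of_nonneg (by positivity) hR.le,
      ← ENNReal.ofReal_mul (by positivity)]
    refine ENNReal.ofReal_le_ofReal ?_
    rw [Real.mul_rpow hA.le (by positivity), ← Real.rpow_mul h2.le]
    -- `hexp` says that the decay of `b k` ^ R does not exceed the growth 2^k of the volume of `X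
    -- k`.
    have hone : 1 ≤ (2 : ℝ) ^ (-(ν + P * lam) * k * R) * 2 ^ k := by
      rw [← Real.rpow_natCast 2 k, ← Real.rpow_add h2]
      refine Real.one_le_rpow (by norm_num) ?_
      have : (ν + P * lam) * R ≤ 1 := by
        calc _ ≤ R⁻¹ * R := by rw [hPQ]; gcongr
          _ = 1 := inv_mul_cancel₀ hR.ne'
      have hk : (0 : ℝ) ≤ k := Nat.cast_nonneg k
      nlinarith
    have hAξ : 0 < (2 * w * c * ℓ ^ (-P)) ^ R * ξ := by positivity
    nlinarith [mul_le_mul_of_nonneg_left hone hAξ.le]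
  · intro N hN
    set F : ℝ → ℝ := fun y => ∑ k ∈ Finset.range N, (E k).indicator (fun _ => α k) y with hF
    have hFm : Measurable F := Finset.measurable_sum _ fun k _ =>
      measurable_const.indicator (hE k)
    have hFle := eLpNorm_sum_indicator_le hp0 hE hEd hℓk hEℓ N
    have hind0 : ∀ k y, 0 ≤ (E k).indicator (fun _ => α k) y := fun k y =>
      indicator_nonneg (fun _ _ => (hα0 k).le) y
    refine ⟨fun y => (F y : ℂ), g, ⟨?_, ?_⟩, memLp_ofReal_indicator_one q, ?_, ?_⟩
    · exact (Complex.measurable_ofReal.comp hFm).aestronglyMeasurable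
    · exact hFle.trans_lt ENNReal.ofReal_lt_top
    · rw [mul_comm, ENNReal.ofReal_mul ENNReal.toReal_nonneg, ENNReal.ofReal_toReal hD]
      gcongr
    · intro k hk x hx
      obtain ⟨t₁, t₂, ht₁, ht₂, hs⟩ := h k x hx
      refine H.le_bilinearMaximal (G := (Icc (-1 : ℝ) 1).indicator (fun _ => (1 : ℝ)))
        (BF := ∑ k ∈ Finset.range N, α k) (BG := 1) hFm
        (measurable_const.indicator measurableSet_Icc)
        (fun y => Finset.sum_nonneg fun k _ => hind0 k y)
        (fun y => indicator_nonneg (fun _ _ => zero_le_one) y)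
        (fun y => Finset.sum_le_sum fun k _ => indicator_le_self' (fun _ _ => (hα0 k).le) y)
        (fun y => indicator_le_self' (fun _ _ => zero_le_one) y) ht₁ ht₂
        (σ := σ) (hα0 k).le hc.le fun s hsw => ?_
      obtain ⟨h1, h2, h3⟩ := hs s hsw
      refine ⟨?_, ?_, h3⟩
      · refine le_trans (le_of_eq ?_) (Finset.single_le_sum
          (f := fun k => (E k).indicator (fun _ => α k) (x - t₁ * (γ s).1))
          (fun k _ => hind0 k _) (Finset.mem_range.2 hk))
        simp only [indicator_of_mem h1]
      · rw [indicator_of_mem (show _ ∈ Icc (-1 : ℝ) 1 from abs_le.1 h2)]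

/-! ### Necessity: tests at a point of contact -/

/-- Near `σ` the curve is a graph, the cutoff is bounded below, and the second component has
contact of order `μ` with its value at `σ`. -/
def ContactAt (γ : ℝ → ℝ × ℝ) (ψ : ℝ → ℝ) (σ : ℝ) (μ : ℕ) : Prop :=
  ∃ ρ c L : ℝ, 0 < ρ ∧ 0 < c ∧ 0 < L ∧ ∀ s, |s - σ| < ρ →
    (γ s).1 = s ∧ c ≤ ψ s ∧ |(γ s).2 - (γ σ).2| ≤ L * |s - σ| ^ μ

theorem pairwise_disjoint_dyadic : Pairwise fun i j : ℕ =>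
    Disjoint (Ico ((2 : ℝ) ^ i) (2 ^ (i + 1))) (Ico ((2 : ℝ) ^ j) (2 ^ (j + 1))) :=
  (pow_right_mono₀ (by norm_num : (1 : ℝ) ≤ 2)).pairwise_disjoint_on_Ico_succ

theorem volume_preimage_inv_mul_Ico {η : ℝ} (hη : η ≠ 0) {u v : ℝ} :
    volume ((fun x => η⁻¹ * x) ⁻¹' Ico u v) = ENNReal.ofReal (|η| * (v - u)) := by
  rw [Real.volume_preimage_mul_left (inv_ne_zero hη), inv_inv, Real.volume_Ico,
    ENNReal.ofReal_mul (abs_nonneg _)]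

theorem measurableSet_preimage_inv_mul_Ico {η u v : ℝ} :
    MeasurableSet ((fun x => η⁻¹ * x) ⁻¹' Ico u v) :=
  measurableSet_Ico.preimage (measurable_const_mul _)

/-- With y = t₂ ≈ 2^k and δ = |s - σ|, contact of order μ moves the second variable by at most
yLδ^μ; this fixes the window length 2^{-k/μ}. -/
theorem contact_window {L w y δ ν : ℝ} {μ k : ℕ} (hμ : 1 ≤ μ) (hν : ν = (μ : ℝ)⁻¹) (hL : 0 < L)
    (hw : 0 < w) (hw1 : w ≤ 1) (hwL : w * (2 * L) ≤ 1) (hy : y ≤ 2 ^ (k + 1))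
    (hδ0 : 0 ≤ δ) (hδ : δ ≤ w * (2 : ℝ) ^ (-(ν * k))) : y * (L * δ ^ μ) ≤ 1 := by
  have hμ0 : (μ : ℝ) ≠ 0 := by positivity
  have h1 : δ ^ μ ≤ w * ((2 : ℝ) ^ k)⁻¹ := by
    calc δ ^ μ ≤ (w * (2 : ℝ) ^ (-(ν * k))) ^ μ := pow_le_pow_left₀ hδ0 hδ _
      _ = w ^ μ * ((2 : ℝ) ^ k)⁻¹ := by
        rw [mul_pow, ← Real.rpow_mul_natCast (by norm_num), ← Real.rpow_natCast 2 k,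
          ← Real.rpow_neg (by norm_num)]
        congr 2
        rw [hν]; field_simp
      _ ≤ w * ((2 : ℝ) ^ k)⁻¹ := by
        gcongr
        exact pow_le_of_le_one hw.le hw1 (by omega)
  calc y * (L * δ ^ μ) ≤ 2 ^ (k + 1) * (L * (w * ((2 : ℝ) ^ k)⁻¹)) := by gcongr
    _ = w * (2 * L) := by rw [pow_succ]; field_simp
    _ ≤ 1 := hwL

theorem window_le {w ν : ℝ} (k : ℕ) (hw : 0 < w) (hν : 0 ≤ ν) :
    w * (2 : ℝ) ^ (-(ν * k)) ≤ w :=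
  mul_le_of_le_one_right hw.le (Real.rpow_le_one_of_one_le_of_nonpos (by norm_num)
    (neg_nonpos.2 (mul_nonneg hν (Nat.cast_nonneg k))))

section Necessity

variable {γ : ℝ → ℝ × ℝ} {ψ : ℝ → ℝ} {S : Set ℝ} {p q r : ℝ≥0∞} {σ : ℝ} {μ : ℕ}

theorem MaximalEstimate.contact_exponent_lt (hest : MaximalEstimate γ ψ p q r)
    (H : CurveCutoff γ ψ S) (hp0 : 0 < p) (hq0 : 0 < q) (hr : r⁻¹ = p⁻¹ + q⁻¹) (hqt : q ≠ ⊤)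
    (hσ : σ ≠ 0) (hη : (γ σ).2 ≠ 0) (hμ : 1 ≤ μ) (hcon : ContactAt γ ψ σ μ) :
    μ * (q⁻¹).toReal + (p⁻¹).toReal < 1 := by
  by_contra hexp
  rw [not_lt] at hexp
  obtain ⟨ρ, c, L, hρ, hc, hL, hloc⟩ := hcon
  set η := (γ σ).2
  have hμ0 : (0 : ℝ) < μ := by exact_mod_cast hμ
  have hμ1 : (1 : ℝ) ≤ μ := by exact_mod_cast hμ
  -- The ratio η/σ may be negative; adding Λ 2^k to (η/σ)y keeps t₁ positive and merely moves the
  -- centre of `E k` to -σΛ2^k.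
  set Λ : ℝ := 2 * |η / σ| + 1
  have hΛ : 0 < Λ := by positivity
  have hσ' : 0 < |σ| := abs_pos.2 hσ
  set ν : ℝ := (μ : ℝ)⁻¹ with hν
  have hν0 : 0 ≤ ν := by positivity
  have hν1 : ν ≤ 1 := inv_le_one_of_one_le₀ hμ1
  obtain ⟨w, hw0, hw⟩ : ∃ w, 0 < w ∧ w < min (min ρ 1) (min (|σ| / 8) (1 / (2 * L))) :=
    exists_between (by positivity)
  have hwρ : w < ρ := hw.trans_le ((min_le_left _ _).trans (min_le_left _ _))
  have hw1 : w < 1 := hw.trans_le ((min_le_left _ _).trans (min_le_right _ _))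
  have hwσ : w < |σ| / 8 := hw.trans_le ((min_le_right _ _).trans (min_le_left _ _))
  have hwL : w < 1 / (2 * L) := hw.trans_le ((min_le_right _ _).trans (min_le_right _ _))
  rw [lt_div_iff₀ (by positivity)] at hwL
  have hpow : ∀ k : ℕ, (2 : ℝ) ^ ((1 - ν) * k) = 2 ^ k * (2 : ℝ) ^ (-(ν * k)) := fun k => by
    rw [← Real.rpow_natCast 2 k, ← Real.rpow_add (by norm_num)]; ring_nf
  have hpow1 : ∀ k : ℕ, (2 : ℝ) ^ (-(ν * k)) ≤ 1 := fun k => by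
    simpa using window_le k one_pos hν0
  refine hest.false_of_dyadic H hp0 hq0 hr hqt (σ := σ) (ν := ν) (lam := 1 - ν) (w := w) (c := c)
    (ℓ := 4 * Λ * w) (ξ := |η|)
    (E := fun k => Metric.ball (-(σ * Λ * 2 ^ k)) (2 * Λ * w * (2 : ℝ) ^ ((1 - ν) * k)))
    (X := fun k => (fun x => η⁻¹ * x) ⁻¹' Ico (2 ^ k) (2 ^ (k + 1)))
    (by positivity) (abs_pos.2 hη) hw0 hc (fun _ => measurableSet_ball) ?_ ?_
    (fun _ => measurableSet_preimage_inv_mul_Ico)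
    (fun i j hij => (pairwise_disjoint_dyadic hij).preimage _) ?_ ?_ ?_
  · refine (pairwise_disjoint_on _).2 fun j k hjk => Metric.ball_disjoint_ball ?_
    have h1 : (2 : ℝ) ^ (j + 1) ≤ 2 ^ k := pow_le_pow_right₀ (by norm_num) hjk
    have hj : (0 : ℝ) < 2 ^ j := by positivity
    have hk : (0 : ℝ) < 2 ^ k := by positivity
    rw [pow_succ] at h1
    have hE : ∀ i : ℕ, 2 * Λ * w * (2 : ℝ) ^ ((1 - ν) * i) ≤ Λ * |σ| / 4 * 2 ^ i := fun i => by
      rw [hpow]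
      have hi : (0 : ℝ) < 2 ^ i := by positivity
      calc _ ≤ 2 * Λ * (|σ| / 8) * (2 ^ i * 1) := by gcongr; exact hpow1 i
        _ = _ := by ring
    rw [Real.dist_eq, show -(σ * Λ * 2 ^ j) - -(σ * Λ * 2 ^ k) = σ * (Λ * (2 ^ k - 2 ^ j)) by ring,
      abs_mul, abs_of_nonneg (mul_nonneg hΛ.le (by linarith))]
    have hΛσ : 0 < Λ * |σ| := by positivity
    nlinarith [hE j, hE k, mul_le_mul_of_nonneg_left h1 hΛσ.le]
  · intro k
    rw [Real.volume_ball]; congr 1; ring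
  · intro k
    rw [volume_preimage_inv_mul_Ico hη]; congr 1; ring
  -- With ν = 1/μ and λ = 1 - ν, the exponent condition is exactly the negated claim μ/q + 1/p ≥ 1.
  · have : ν * (1 - (p⁻¹).toReal) ≤ (q⁻¹).toReal := by
      rw [hν, inv_mul_le_iff₀ hμ0]; linarith
    linarith
  · intro k x hx
    set y := η⁻¹ * x with hy
    have hxy : x = η * y := by rw [hy]; field_simp
    obtain ⟨hy1, hy2⟩ : 2 ^ k ≤ y ∧ y < 2 ^ (k + 1) := hx
    have hk : (0 : ℝ) < 2 ^ k := by positivity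
    have hy0 : 0 < y := hk.trans_le hy1
    have habs : |η / σ * y| ≤ 2 * |η / σ| * 2 ^ k := by
      rw [abs_mul, abs_of_pos hy0]
      calc _ ≤ |η / σ| * 2 ^ (k + 1) := by gcongr
        _ = _ := by ring
    have hΛk : Λ * 2 ^ k = 2 * |η / σ| * 2 ^ k + 2 ^ k := by ring
    have hb := abs_le.1 habs
    have ht₁ : 0 < η / σ * y + Λ * 2 ^ k := by linarith [hb.1]
    refine ⟨η / σ * y + Λ * 2 ^ k, y, ht₁, hy0, fun s hs => ?_⟩
    obtain ⟨l1, l2, l3⟩ := hloc s ((hs.trans_le (window_le k hw0 hν0)).trans hwρ)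
    refine ⟨?_, ?_, l2⟩
    · rw [Metric.mem_ball, Real.dist_eq, l1, hpow,
        show x - (η / σ * y + Λ * 2 ^ k) * s - -(σ * Λ * 2 ^ k) =
          (η / σ * y + Λ * 2 ^ k) * -(s - σ) by rw [hxy]; field_simp; ring,
        abs_mul, abs_neg, abs_of_pos ht₁]
      calc _ ≤ (2 * Λ * 2 ^ k) * |s - σ| := by gcongr; linarith [hb.2]
        _ < (2 * Λ * 2 ^ k) * (w * (2 : ℝ) ^ (-(ν * k))) := by gcongr
        _ = _ := by ring
    · rw [hxy, show η * y - y * (γ s).2 = y * -((γ s).2 - η) by ring, abs_mul, abs_neg,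
        abs_of_pos hy0]
      exact (mul_le_mul_of_nonneg_left l3 hy0.le).trans
        (contact_window hμ hν hL hw0 hw1.le hwL.le hy2.le (abs_nonneg _) hs.le)

/-- At σ = 0 a bounded t₁ makes x - t₁s stay close to x, so `E k` can be a whole dyadic shell around
`X k`. Then λ = 1, p drops out, and the condition becomes 1/μ ≤ 1/q. -/
theorem MaximalEstimate.contact_exponent_lt_of_zero (hest : MaximalEstimate γ ψ p q r)
    (H : CurveCutoff γ ψ S) (hp0 : 0 < p) (hq0 : 0 < q) (hr : r⁻¹ = p⁻¹ + q⁻¹) (hqt : q ≠ ⊤)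
    (hη : (γ 0).2 ≠ 0) (hμ : 1 ≤ μ) (hcon : ContactAt γ ψ 0 μ) :
    μ * (q⁻¹).toReal < 1 := by
  by_contra hexp
  rw [not_lt] at hexp
  obtain ⟨ρ, c, L, hρ, hc, hL, hloc⟩ := hcon
  set η := (γ 0).2
  have hμ0 : (0 : ℝ) < μ := by exact_mod_cast hμ
  set ν : ℝ := (μ : ℝ)⁻¹ with hν
  have hν0 : 0 ≤ ν := by positivity
  obtain ⟨w, hw0, hw⟩ : ∃ w, 0 < w ∧ w < min ρ (min (1 / 4) (1 / (2 * L))) :=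
    exists_between (by positivity)
  have hwρ : w < ρ := hw.trans_le (min_le_left _ _)
  have hw1 : w < 1 / 4 := hw.trans_le ((min_le_right _ _).trans (min_le_left _ _))
  have hwL : w < 1 / (2 * L) := hw.trans_le ((min_le_right _ _).trans (min_le_right _ _))
  rw [lt_div_iff₀ (by positivity)] at hwL
  have hsub : ∀ k : ℕ, Ico (5 / 4 * (2 : ℝ) ^ k) (7 / 4 * 2 ^ k) ⊆ Ico (2 ^ k) (2 ^ (k + 1)) :=
    fun k => by
      have hk : (0 : ℝ) < 2 ^ k := by positivity
      refine Ico_subset_Ico (by linarith) ?_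
      rw [pow_succ]; linarith
  refine hest.false_of_dyadic H hp0 hq0 hr hqt (σ := 0) (ν := ν) (lam := 1) (w := w) (c := c)
    (ℓ := |η|) (ξ := |η| / 2)
    (E := fun k => (fun x => η⁻¹ * x) ⁻¹' Ico (2 ^ k) (2 ^ (k + 1)))
    (X := fun k => (fun x => η⁻¹ * x) ⁻¹' Ico (5 / 4 * 2 ^ k) (7 / 4 * 2 ^ k))
    (abs_pos.2 hη) (by positivity) hw0 hc
    (fun _ => measurableSet_preimage_inv_mul_Ico)
    (fun i j hij => (pairwise_disjoint_dyadic hij).preimage _) ?_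
    (fun _ => measurableSet_preimage_inv_mul_Ico)
    (fun i j hij => ((pairwise_disjoint_dyadic hij).mono (hsub i) (hsub j)).preimage _) ?_ ?_ ?_
  · intro k
    rw [volume_preimage_inv_mul_Ico hη, one_mul, Real.rpow_natCast]; congr 1; ring
  · intro k
    rw [volume_preimage_inv_mul_Ico hη]; congr 1; ring
  · have : ν ≤ (q⁻¹).toReal := by
      rw [hν, inv_le_iff_one_le_mul₀ hμ0]; linarith
    linarith
  · intro k x hx
    set y := η⁻¹ * x with hy
    have hxy : x = η * y := by rw [hy]; field_simp
    have hxs := hsub k hx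
    obtain ⟨hy1, hy2⟩ : 5 / 4 * 2 ^ k ≤ y ∧ y < 7 / 4 * 2 ^ k := hx
    obtain ⟨-, hy3⟩ : 2 ^ k ≤ y ∧ y < 2 ^ (k + 1) := hxs
    have hk : (1 : ℝ) ≤ 2 ^ k := one_le_pow₀ (by norm_num)
    have hy0 : 0 < y := by linarith
    refine ⟨|η|, y, abs_pos.2 hη, hy0, fun s hs => ?_⟩
    have hsw := hs.trans_le (window_le k hw0 hν0)
    obtain ⟨l1, l2, l3⟩ := hloc s (hsw.trans hwρ)
    refine ⟨?_, ?_, l2⟩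
    · rw [l1, mem_preimage, show η⁻¹ * (x - |η| * s) = y - η⁻¹ * |η| * s by rw [hy]; ring]
      have habs : |η⁻¹ * |η| * s| < 1 / 4 := by
        rw [abs_mul, abs_mul, abs_inv, abs_abs, inv_mul_cancel₀ (abs_pos.2 hη).ne', one_mul]
        rw [sub_zero] at hsw
        exact hsw.trans hw1
      have := abs_lt.1 habs
      rw [pow_succ]
      constructor <;> linarith
    · rw [hxy, show η * y - y * (γ s).2 = y * -((γ s).2 - η) by ring, abs_mul, abs_neg,
        abs_of_pos hy0]
      exact (mul_le_mul_of_nonneg_left l3 hy0.le).trans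
        (contact_window hμ hν hL hw0 (by linarith) hwL.le hy3.le (abs_nonneg _) hs.le)

/-- With g = 1 and f the indicator of [-1,1], 𝓜(f,g) is at least a multiple of 1/|x| at large x on
one half-line, which is not in L^r for r ≤ 1. The test pair does not depend on N, hence θ = 0. -/
theorem MaximalEstimate.inv_lt_one_of_top (hest : MaximalEstimate γ ψ p ⊤ r)
    (H : CurveCutoff γ ψ S) (hp0 : 0 < p) (hr : r⁻¹ = p⁻¹ + (⊤ : ℝ≥0∞)⁻¹)
    (hσ : σ ≠ 0) (hcon : ContactAt γ ψ σ μ) : (p⁻¹).toReal < 1 := by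
  by_contra hexp
  rw [not_lt] at hexp
  obtain ⟨ρ, c, L, hρ, hc, hL, hloc⟩ := hcon
  have hPQ := toReal_inv_holder hp0 ENNReal.zero_lt_top hr
  rw [ENNReal.inv_top, ENNReal.toReal_zero, add_zero] at hPQ
  obtain ⟨hr0, hrt⟩ := holder_exponent_ne hp0 ENNReal.zero_lt_top hr (by
    rw [ENNReal.inv_top, ENNReal.toReal_zero, add_zero]; linarith)
  have hR : 0 < r.toReal := ENNReal.toReal_pos hr0 hrt
  have hR1 : r.toReal ≤ 1 := by
    rw [← hPQ] at hexp
    exact (one_le_inv₀ hR).1 hexp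
  set R := r.toReal
  obtain ⟨w, hw0, hw⟩ : ∃ w, 0 < w ∧ w < min ρ 1 := exists_between (by positivity)
  have hwρ : w < ρ := hw.trans_le (min_le_left _ _)
  have hw1 : w < 1 := hw.trans_le (min_le_right _ _)
  have hD := (memLp_ofReal_indicator_one p).2.ne
  set f : ℝ → ℂ := fun y => (((Icc (-1 : ℝ) 1).indicator (fun _ => (1 : ℝ)) y : ℝ) : ℂ)
  have hσ' : 0 < |σ| := abs_pos.2 hσ
  refine hest.false_of_tests hr0 hrt (θ := 0) (κ := (w * c) ^ R * |σ|)
    (D := (eLpNorm f p volume * eLpNorm (fun _ : ℝ => ((1 : ℝ) : ℂ)) ⊤ volume).toReal)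
    (b := fun k => 2 * (w * (2 ^ (k + 1))⁻¹) * 1 * c)
    (X := fun k => (fun x => σ⁻¹ * x) ⁻¹' Ico (2 ^ k) (2 ^ (k + 1)))
    (by positivity) (by positivity) (fun _ => measurableSet_preimage_inv_mul_Ico)
    (fun i j hij => (pairwise_disjoint_dyadic hij).preimage _) ?_ ?_
  · intro k
    have hk : (0 : ℝ) < 2 ^ k := by positivity
    rw [volume_preimage_inv_mul_Ico hσ, ENNReal.ofReal_rpow_of_nonneg (by positivity) hR.le,
      ← ENNReal.ofReal_mul (by positivity)]
    refine ENNReal.ofReal_le_ofReal ?_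
    have e1 : 2 * (w * ((2 : ℝ) ^ (k + 1))⁻¹) * 1 * c = w * c * (2 ^ k)⁻¹ := by
      rw [pow_succ]; field_simp
    rw [e1, Real.mul_rpow (x := w * c) (by positivity) (by positivity),
      show |σ| * ((2 : ℝ) ^ (k + 1) - 2 ^ k) = |σ| * 2 ^ k by ring, Real.inv_rpow hk.le]
    have h1 : ((2 : ℝ) ^ k) ^ R ≤ 2 ^ k := by
      calc _ ≤ ((2 : ℝ) ^ k) ^ (1 : ℝ) :=
            Real.rpow_le_rpow_of_exponent_le (one_le_pow₀ (by norm_num)) hR1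
        _ = _ := Real.rpow_one _
    have h2 : (0 : ℝ) < (2 ^ k) ^ R := by positivity
    calc (w * c) ^ R * |σ| = (w * c) ^ R * ((2 ^ k) ^ R)⁻¹ * (|σ| * (2 ^ k) ^ R) := by field_simp
      _ ≤ _ := by gcongr
  · intro N hN
    have hg : MemLp (fun _ : ℝ => ((1 : ℝ) : ℂ)) ⊤ volume := memLp_top_const _
    refine ⟨f, fun _ => ((1 : ℝ) : ℂ), memLp_ofReal_indicator_one p, hg, ?_, ?_⟩
    · rw [Real.rpow_zero, mul_one, ENNReal.ofReal_toReal (ENNReal.mul_ne_top hD hg.2.ne)]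
    · intro k hk x hx
      set y := σ⁻¹ * x with hy
      have hxy : x = σ * y := by rw [hy]; field_simp
      obtain ⟨hy1, hy2⟩ : 2 ^ k ≤ y ∧ y < 2 ^ (k + 1) := hx
      have hy0 : 0 < y := lt_of_lt_of_le (by positivity) hy1
      have hk1 : (1 : ℝ) ≤ 2 ^ (k + 1) := one_le_pow₀ (by norm_num)
      refine H.le_bilinearMaximal (F := (Icc (-1 : ℝ) 1).indicator (fun _ => (1 : ℝ)))
        (G := fun _ => 1) (BF := 1) (BG := 1)
        (measurable_const.indicator measurableSet_Icc) measurable_const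
        (fun y => indicator_nonneg (fun _ _ => zero_le_one) y) (fun _ => zero_le_one)
        (fun y => indicator_le_self' (fun _ _ => zero_le_one) y) (fun _ => le_rfl) hy0
        one_pos (σ := σ) zero_le_one hc.le fun s hs => ?_
      have hsw : |s - σ| < w := hs.trans_le
        (mul_le_of_le_one_right hw0.le (inv_le_one_of_one_le₀ hk1))
      obtain ⟨l1, l2, -⟩ := hloc s (hsw.trans hwρ)
      refine ⟨?_, le_rfl, l2⟩
      have : |x - y * (γ s).1| ≤ 1 := by
        rw [l1, hxy, show σ * y - y * s = y * -(s - σ) by ring, abs_mul, abs_neg,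
          abs_of_pos hy0]
        calc _ ≤ 2 ^ (k + 1) * (w * (2 ^ (k + 1))⁻¹) := by gcongr
          _ = w := by field_simp
          _ ≤ 1 := hw1.le
      rw [indicator_of_mem (show _ ∈ Icc (-1 : ℝ) 1 from abs_le.1 this)]

end Necessity

/-! ### Taylor expansion at a point of finite type -/

theorem isLittleO_sub_of_iteratedDeriv_eq_zero {F : ℝ → ℝ} {a b s₀ : ℝ} {n : ℕ} (hn : 1 ≤ n)
    (hF : ContDiffOn ℝ n F (Ioo a b)) (hs₀ : s₀ ∈ Ioo a b)
    (h : ∀ k, 1 ≤ k → k < n → iteratedDeriv k F s₀ = 0) :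
    (fun s => F s - F s₀ - iteratedDeriv n F s₀ / n.factorial * (s - s₀) ^ n) =o[𝓝 s₀]
      fun s => (s - s₀) ^ n := by
  have ht := taylor_isLittleO (convex_Ioo a b) hs₀ hF
  rw [isOpen_Ioo.nhdsWithin_eq hs₀] at ht
  refine ht.congr_left fun s => ?_
  have e : ∀ k, iteratedDerivWithin k F (Ioo a b) s₀ = iteratedDeriv k F s₀ := fun k =>
    iteratedDerivWithin_of_isOpen isOpen_Ioo hs₀
  rw [taylor_within_apply, Finset.sum_range_succ, Finset.sum_eq_single 0]
  · simp only [e, smul_eq_mul, iteratedDeriv_zero, Nat.factorial_zero, pow_zero]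
    simp only [Nat.cast_one, inv_one, mul_one, one_mul]
    ring
  · intro k hk hk0
    rw [e, h k (by omega) (Finset.mem_range.1 hk), smul_zero]
  · intro h0
    exact absurd (Finset.mem_range.2 (by omega)) h0

theorem eventually_bounds_of_iteratedDeriv {F : ℝ → ℝ} {a b s₀ : ℝ} {n : ℕ} (hn : 1 ≤ n)
    (hF : ContDiffOn ℝ n F (Ioo a b)) (hs₀ : s₀ ∈ Ioo a b)
    (h : ∀ k, 1 ≤ k → k < n → iteratedDeriv k F s₀ = 0) (hne : iteratedDeriv n F s₀ ≠ 0) :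
    ∃ c C : ℝ, 0 < c ∧ 0 < C ∧ ∀ᶠ s in 𝓝 s₀,
      c * |s - s₀| ^ n ≤ |F s - F s₀| ∧ |F s - F s₀| ≤ C * |s - s₀| ^ n := by
  set A := iteratedDeriv n F s₀ / n.factorial with hA
  have hA0 : 0 < |A| := abs_pos.2 (div_ne_zero hne (by exact_mod_cast n.factorial_ne_zero))
  refine ⟨|A| / 2, 2 * |A|, by positivity, by positivity, ?_⟩
  filter_upwards [(isLittleO_sub_of_iteratedDeriv_eq_zero hn hF hs₀ h).bound (half_pos hA0)]
    with s hs
  rw [← hA, Real.norm_eq_abs, Real.norm_eq_abs, abs_pow] at hs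
  have e : |A * (s - s₀) ^ n| = |A| * |s - s₀| ^ n := by rw [abs_mul, abs_pow]
  have h0 : 0 ≤ |A| * |s - s₀| ^ n := by positivity
  have h1 := abs_sub_abs_le_abs_sub (A * (s - s₀) ^ n) (F s - F s₀)
  rw [abs_sub_comm (A * (s - s₀) ^ n) (F s - F s₀), e] at h1
  have h2 := abs_sub_abs_le_abs_sub (F s - F s₀) (A * (s - s₀) ^ n)
  rw [e] at h2
  constructor <;> linarith

/-- Taylor's formula is used twice: to order m for h, and to order m - 1 for h', which vanishes at
s₀ because m ≥ 2. -/
theorem IsOfType.eventually_bounds {h : ℝ → ℝ} {a b s₀ : ℝ} {m : ℕ} (htype : IsOfType m h s₀)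
    (hm : 2 ≤ m) (hh : ContDiffOn ℝ ∞ h (Ioo a b)) (hs₀ : s₀ ∈ Ioo a b) :
    ∃ c C : ℝ, 0 < c ∧ 0 < C ∧ ∀ᶠ s in 𝓝 s₀, HasDerivAt h (deriv h s) s ∧
      c * |s - s₀| ^ (m - 1) ≤ |deriv h s| ∧ |h s - h s₀| ≤ C * |s - s₀| ^ m := by
  obtain ⟨hz, hne⟩ := htype
  have hd0 : deriv h s₀ = 0 := by
    have := hz 1 le_rfl (by omega)
    rwa [iteratedDeriv_one] at this
  have hh' : ContDiffOn ℝ ∞ (deriv h) (Ioo a b) := hh.deriv_of_isOpen isOpen_Ioo (by simp)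
  obtain ⟨_, C, _, hC, hCe⟩ := eventually_bounds_of_iteratedDeriv (n := m) (by omega)
    (contDiffOn_infty.1 hh m) hs₀ hz hne
  obtain ⟨c, _, hc, _, hce⟩ := eventually_bounds_of_iteratedDeriv (F := deriv h) (n := m - 1)
    (by omega) (contDiffOn_infty.1 hh' (m - 1)) hs₀
    (fun k hk1 hk2 => by
      rw [← iteratedDeriv_succ']; exact hz (k + 1) (by omega) (by omega))
    (by rw [← iteratedDeriv_succ', Nat.sub_add_cancel (by omega)]; exact hne)
  refine ⟨c, C, hc, hC, ?_⟩
  filter_upwards [hCe, hce, isOpen_Ioo.mem_nhds hs₀] with s h1 h2 hs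
  rw [hd0, sub_zero] at h2
  exact ⟨((hh.contDiffAt (isOpen_Ioo.mem_nhds hs)).differentiableAt (by simp)).hasDerivAt,
    h2.1, h1.2⟩

/-! ### Translation of the exponent conditions -/

section Exponents

variable {p q r : ℝ≥0∞}

theorem lt_one_iff_toReal {x : ℝ≥0∞} (hx : x ≠ ⊤) : x < 1 ↔ x.toReal < 1 := by
  rw [← ENNReal.ofReal_one]; exact ENNReal.lt_ofReal_iff_toReal_lt hx

theorem one_lt_iff_inv (hp0 : 0 < p) : 1 < p ↔ (p⁻¹).toReal < 1 := by
  rw [← ENNReal.inv_lt_one, lt_one_iff_toReal (ENNReal.inv_ne_top.2 hp0.ne')]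

theorem one_lt_iff_holder (hp0 : 0 < p) (hq0 : 0 < q) (hr : r⁻¹ = p⁻¹ + q⁻¹) :
    1 < r ↔ (p⁻¹).toReal + (q⁻¹).toReal < 1 := by
  have hp := ENNReal.inv_ne_top.2 hp0.ne'
  have hq := ENNReal.inv_ne_top.2 hq0.ne'
  rw [← ENNReal.inv_lt_one, hr, lt_one_iff_toReal (ENNReal.add_ne_top.2 ⟨hp, hq⟩),
    ENNReal.toReal_add hp hq]

theorem mul_inv_add_inv_lt_one_iff (hp0 : 0 < p) (hq0 : 0 < q) (m : ℕ) :
    (m : ℝ≥0∞) / q + 1 / p < 1 ↔ m * (q⁻¹).toReal + (p⁻¹).toReal < 1 := by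
  have hp := ENNReal.inv_ne_top.2 hp0.ne'
  have hq := ENNReal.mul_ne_top (ENNReal.natCast_ne_top m) (ENNReal.inv_ne_top.2 hq0.ne')
  rw [one_div, div_eq_mul_inv, lt_one_iff_toReal (ENNReal.add_ne_top.2 ⟨hq, hp⟩),
    ENNReal.toReal_add hq hp, ENNReal.toReal_mul, ENNReal.toReal_natCast]

theorem natCast_lt_iff (hq0 : 0 < q) {m : ℕ} (hm : 1 ≤ m) :
    (m : ℝ≥0∞) < q ↔ m * (q⁻¹).toReal < 1 := by
  have hm0 : (0 : ℝ) < m := by exact_mod_cast hm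
  rw [← ENNReal.inv_lt_inv, show ((m : ℝ≥0∞))⁻¹ = ENNReal.ofReal (m : ℝ)⁻¹ by
    rw [ENNReal.ofReal_inv_of_pos hm0, ENNReal.ofReal_natCast],
    ENNReal.lt_ofReal_iff_toReal_lt (ENNReal.inv_ne_top.2 hq0.ne'),
    ← one_div (m : ℝ), lt_div_iff₀ hm0, mul_comm]

end Exponents

/-! ### Localisation and the conclusion -/

section Local

variable {m : ℕ} {γ : ℝ → ℝ × ℝ} {dh ψ : ℝ → ℝ} {s₀ ε c C : ℝ} {p q r : ℝ≥0∞}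

theorem FiniteTypeOn.curveCutoff (H : FiniteTypeOn m (fun s => (γ s).2) dh s₀ ε c C)
    (hγ : ∀ s, |s - s₀| < ε → (γ s).1 = s) (hψc : Continuous ψ) (hψs : HasCompactSupport ψ)
    (hψ0 : ∀ s, 0 ≤ ψ s) (hψS : ∀ s, ε ≤ |s - s₀| → ψ s = 0) :
    CurveCutoff γ ψ (Metric.ball s₀ ε) where
  measurableSet := measurableSet_ball
  continuous := hψc
  hasCompactSupport := hψs
  nonneg := hψ0
  eq_zero s hs := hψS s (not_lt.1 (by simpa [Real.dist_eq] using hs))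
  aemeasurable_fst := by
    refine AEMeasurable.congr (f := fun s => s) (by fun_prop) ?_
    filter_upwards [ae_restrict_mem measurableSet_ball] with s hs
    exact (hγ s (by simpa [Real.dist_eq] using hs)).symm
  aemeasurable_snd := by
    refine ContinuousOn.aemeasurable (fun s hs => ?_) measurableSet_ball
    exact (H.hasDerivAt s (by simpa [Real.dist_eq] using hs)).continuousAt.continuousWithinAt

theorem contactAt_of_eventually {σ : ℝ} {μ : ℕ} (hψc : Continuous ψ) (hψσ : 0 < ψ σ) {L : ℝ}
    (hL : 0 < L) (h : ∀ᶠ s in 𝓝 σ, (γ s).1 = s ∧ |(γ s).2 - (γ σ).2| ≤ L * |s - σ| ^ μ) :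
    ContactAt γ ψ σ μ := by
  have hψ : ∀ᶠ s in 𝓝 σ, ψ σ / 2 < ψ s :=
    hψc.continuousAt.eventually (lt_mem_nhds (half_lt_self hψσ))
  obtain ⟨ρ, hρ, hb⟩ := Metric.eventually_nhds_iff.1 (h.and hψ)
  refine ⟨ρ, ψ σ / 2, L, hρ, half_pos hψσ, hL, fun s hs => ?_⟩
  obtain ⟨⟨h1, h2⟩, h3⟩ := hb (by rwa [Real.dist_eq])
  exact ⟨h1, h3.le, h2⟩

theorem FiniteTypeOn.contactAt (H : FiniteTypeOn m (fun s => (γ s).2) dh s₀ ε c C)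
    (hγ : ∀ s, |s - s₀| < ε → (γ s).1 = s) (hψc : Continuous ψ) (hψs₀ : 0 < ψ s₀) :
    ContactAt γ ψ s₀ m := by
  refine contactAt_of_eventually hψc hψs₀ H.upper_pos ?_
  filter_upwards [Metric.ball_mem_nhds s₀ H.radius_pos] with s hs
  rw [Metric.mem_ball, Real.dist_eq] at hs
  exact ⟨hγ s hs, H.upper s hs⟩

/-- Zeros of s and of γ₂ do not accumulate at s₀, so some nearby σ avoids both while ψ stays
positive. Differentiability there gives first order contact, which forces r > 1 whatever the
position of s₀. -/
theorem FiniteTypeOn.exists_contactAt_one (H : FiniteTypeOn m (fun s => (γ s).2) dh s₀ ε c C)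
    (hγ : ∀ s, |s - s₀| < ε → (γ s).1 = s) (hψc : Continuous ψ) (hψs₀ : 0 < ψ s₀) :
    ∃ σ, σ ≠ 0 ∧ (γ σ).2 ≠ 0 ∧ ContactAt γ ψ σ 1 := by
  have hball : Metric.ball s₀ ε ∈ 𝓝 s₀ := Metric.ball_mem_nhds s₀ H.radius_pos
  have hcont : ContinuousAt (fun s => (γ s).2) s₀ :=
    (H.hasDerivAt s₀ (by simpa using H.radius_pos)).continuousAt
  have h1 : ∀ᶠ s in 𝓝[≠] s₀, s ≠ 0 := by
    by_cases h0 : s₀ = 0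
    · rw [h0]; exact self_mem_nhdsWithin
    · exact eventually_nhdsWithin_of_eventually_nhds (isOpen_ne.mem_nhds h0)
  have h2 : ∀ᶠ s in 𝓝[≠] s₀, (γ s).2 ≠ 0 := by
    by_cases h0 : (γ s₀).2 = 0
    · filter_upwards [self_mem_nhdsWithin, mem_nhdsWithin_of_mem_nhds hball] with s hs hs'
      rw [Metric.mem_ball, Real.dist_eq] at hs'
      have := H.ne_value hs' hs
      simp only [h0] at this
      exact this
    · exact eventually_nhdsWithin_of_eventually_nhds
        (hcont.eventually (isOpen_ne.mem_nhds h0))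
  have h3 : ∀ᶠ s in 𝓝[≠] s₀, 0 < ψ s :=
    eventually_nhdsWithin_of_eventually_nhds (hψc.continuousAt.eventually (lt_mem_nhds hψs₀))
  obtain ⟨σ, ⟨⟨hσ0, hσ⟩, hψσ⟩, hσε⟩ :=
    (((h1.and h2).and h3).and (mem_nhdsWithin_of_mem_nhds hball)).exists
  rw [Real.dist_eq] at hσε
  refine ⟨σ, hσ0, hσ, ?_⟩
  obtain ⟨L, hL, hLb⟩ := (H.hasDerivAt σ hσε).isBigO_sub.exists_pos
  refine contactAt_of_eventually hψc hψσ hL ?_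
  filter_upwards [hLb.bound, Metric.isOpen_ball.mem_nhds
    (show σ ∈ Metric.ball s₀ ε by rwa [Metric.mem_ball, Real.dist_eq])] with s hs hsε
  rw [Metric.mem_ball, Real.dist_eq] at hsε
  rw [pow_one]
  exact ⟨hγ s hsε, hs⟩

theorem FiniteTypeOn.holder_lt_one (H : FiniteTypeOn m (fun s => (γ s).2) dh s₀ ε c C)
    (hγ : ∀ s, |s - s₀| < ε → (γ s).1 = s) (hψs₀ : 0 < ψ s₀)
    (Hψ : CurveCutoff γ ψ (Metric.ball s₀ ε)) (hp0 : 0 < p) (hq0 : 0 < q)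
    (hr : r⁻¹ = p⁻¹ + q⁻¹) (hest : MaximalEstimate γ ψ p q r) :
    (p⁻¹).toReal + (q⁻¹).toReal < 1 := by
  obtain ⟨σ, hσ0, hσ, hcon⟩ := H.exists_contactAt_one hγ Hψ.continuous hψs₀
  rcases eq_or_ne q ⊤ with rfl | hqt
  · simpa using hest.inv_lt_one_of_top Hψ hp0 hr hσ0 hcon
  · have := hest.contact_exponent_lt Hψ hp0 hq0 hr hqt hσ0 hσ le_rfl hcon
    rw [Nat.cast_one] at this
    linarith

end Local

theorem theorem1 (a b : ℝ) (γ : ℝ → ℝ × ℝ) (hγ : ContDiffOn ℝ ∞ γ (Ioo a b))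
    (s₀ : ℝ) (hs₀ : s₀ ∈ Ioo a b) (hform : ∀ᶠ s in 𝓝 s₀, (γ s).1 = s)
    (m : ℕ) (hm : 2 ≤ m) (htype : IsOfType m (fun s => (γ s).2) s₀) :
    ∃ U ∈ 𝓝 s₀, ∀ ψ : ℝ → ℝ, ContDiff ℝ ∞ ψ → HasCompactSupport ψ →
      tsupport ψ ⊆ Ioo a b → (∀ s, 0 ≤ ψ s) → tsupport ψ ⊆ U → ψ s₀ ≠ 0 →
      ∀ p q r : ℝ≥0∞, 0 < p → 0 < q → r⁻¹ = p⁻¹ + q⁻¹ →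
        (γ s₀ = 0 →
          (MaximalEstimate γ ψ p q r ↔ 1 < p ∧ 1 < q ∧ 1 < r) ∧
          (1 < p ∧ 1 < q ∧ 1 < r → AveragesConverge γ ψ p q)) ∧
        (γ s₀ ≠ 0 → s₀ = 0 →
          (MaximalEstimate γ ψ p q r ↔ 1 < p ∧ (m : ℝ≥0∞) < q ∧ 1 < r) ∧
          (1 < p ∧ (m : ℝ≥0∞) < q ∧ 1 < r → AveragesConverge γ ψ p q)) ∧
        ((γ s₀).2 ≠ 0 → s₀ ≠ 0 →
          (MaximalEstimate γ ψ p q r ↔ 1 < p ∧ 1 < q ∧ (m : ℝ≥0∞) / q + 1 / p < 1) ∧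
          (1 < p ∧ 1 < q ∧ (m : ℝ≥0∞) / q + 1 / p < 1 → AveragesConverge γ ψ p q)) := by
  have hh : ContDiffOn ℝ ∞ (fun s => (γ s).2) (Ioo a b) := contDiff_snd.comp_contDiffOn hγ
  obtain ⟨c, C, hc, hC, hev⟩ := htype.eventually_bounds hm hh hs₀
  obtain ⟨ε, hε, hb⟩ := Metric.eventually_nhds_iff.1 (hev.and hform)
  simp only [Real.dist_eq] at hb
  have H : FiniteTypeOn m (fun s => (γ s).2) (deriv fun s => (γ s).2) s₀ ε c C :=
    ⟨hε, hc, hC, fun s hs => (hb hs).1.1, fun s hs => (hb hs).1.2.1, fun s hs => (hb hs).1.2.2⟩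
  have hγ1 : ∀ s, |s - s₀| < ε → (γ s).1 = s := fun s hs => (hb hs).2
  -- The neighbourhood depends only on the curve: the finite type bounds and the graph form hold
  -- throughout it.
  refine ⟨Metric.ball s₀ ε, Metric.ball_mem_nhds s₀ hε, ?_⟩
  intro ψ hψ hψs _ hψ0 hψU hψne p q r hp0 hq0 hr
  have hψc := hψ.continuous
  have hψS : ∀ s, ε ≤ |s - s₀| → ψ s = 0 := fun s hs => by
    refine image_eq_zero_of_notMem_tsupport fun hmem => ?_
    have := hψU hmem
    rw [Metric.mem_ball, Real.dist_eq] at this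
    linarith
  have hψpos : 0 < ψ s₀ := lt_of_le_of_ne (hψ0 s₀) hψne.symm
  have Hψ := H.curveCutoff hγ1 hψc hψs hψ0 hψS
  have hP : 0 ≤ (p⁻¹).toReal := ENNReal.toReal_nonneg
  have hQ : 0 ≤ (q⁻¹).toReal := ENNReal.toReal_nonneg
  have hm2 : (2 : ℝ) ≤ m := by exact_mod_cast hm
  have hnec := fun hest : MaximalEstimate γ ψ p q r =>
    H.holder_lt_one hγ1 hψpos Hψ hp0 hq0 hr hest
  rw [one_lt_iff_inv hp0, one_lt_iff_inv hq0, one_lt_iff_holder hp0 hq0 hr,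
    natCast_lt_iff hq0 (by omega : 1 ≤ m), mul_inv_add_inv_lt_one_iff hp0 hq0 m]
  refine ⟨fun h0 => ?_, fun h0 hs0 => ?_, fun h0 hs0 => ?_⟩
  · have hsuff := fun hpq => H.estimate_of_origin hm hγ1 hψc hψs hψS hp0 hq0 hr
      (by rw [h0]; rfl) hpq
    refine ⟨⟨fun hest => ?_, fun h => (hsuff h.2.2).1⟩, fun h => (hsuff h.2.2).2⟩
    have := hnec hest
    exact ⟨by linarith, by linarith, this⟩
  · subst hs0
    have hsuff := fun hpq hq => H.estimate_of_parameter_zero hm hγ1 hψc hψs hψS hp0 hq0 hr hpq hq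
    refine ⟨⟨fun hest => ?_, fun h => (hsuff h.2.2 h.2.1).1⟩, fun h => (hsuff h.2.2 h.2.1).2⟩
    have h1 := hnec hest
    refine ⟨by linarith, ?_, h1⟩
    rcases eq_or_ne q ⊤ with rfl | hqt
    · simp
    · refine hest.contact_exponent_lt_of_zero Hψ hp0 hq0 hr hqt (fun h2 => h0 ?_) (by omega)
        (H.contactAt hγ1 hψc hψpos)
      -- Since γ₁(0) = 0, a nonzero γ(0) must have γ₂(0) ≠ 0.
      exact Prod.ext (hγ1 0 (by simpa using hε)) h2
  · have hsuff := fun hpq => H.estimate_of_generic hm hγ1 hψc hψs hψS hp0 hq0 hr hpq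
    refine ⟨⟨fun hest => ?_, fun h => (hsuff h.2.2).1⟩, fun h => (hsuff h.2.2).2⟩
    have h1 := hnec hest
    refine ⟨by linarith, by linarith, ?_⟩
    rcases eq_or_ne q ⊤ with rfl | hqt
    · simpa using h1
    · exact hest.contact_exponent_lt Hψ hp0 hq0 hr hqt hs0 h0 (by omega)
        (H.contactAt hγ1 hψc hψpos)
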